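/- Let $H\in(1/2,1)$ and let $Y=\{Y(t)\}_{t\in\mathbb Z}$ be a real second-order stationary process with spectral density $h$ in normalised frequency, i.e. $\mathrm{Cov}(Y(s),Y(t))=\int_{-1/2}^{1/2}h(x)e^{2\pi i(t-s)x}\,dx$, where $h$ is positive and continuous on $[-1/2,1/2]$ and three times continuously differentiable on $(-1/2,1/2)$. Let $X=(1-B)^{-(H-1/2)}Y$ be the associated fractionally differenced process, i.e. $X(t)=\sum_{j\ge0}\frac{\Gamma(j+H-1/2)}{\Gamma(H-1/2)\,\Gamma(j+1)}\,Y(t-j)$ in mean square. Let $\gamma$ be the autocovariance function of $X$, $\omega_H(n)=\sum_{k=0}^{n-1}\sum_{i=-k}^{k}\gamma(i)$ its variance time function and $\varphi_H(n)=\omega_H(n)/\omega_H(1)$ its correlation time function; let $\varphi_H^{(m)}$ be the correlation time function of the aggregated process $X^{(m)}(t)=\frac1m\sum_{j=m(t-1)+1}^{mt}X(j)$. Put $c_f=(2\pi)^{1-2H}h(0)$, $C(H)=\pi^{-1}H\,\Gamma(2H)\sin(\pi H)$, $\mathcal V=c_f/\big((2\pi)^{2-2H}C(H)\big)$, and $$f_H(x)=h(x)\,|2\sin\pi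 x|^{-(2H-1)},\qquad f_H^*(x)=c_f\,\pi^{-2}(2\pi)^{2H+1}\sin^2(\pi x)\sum_{j\in\mathbb Z}|2\pi j+2\pi x|^{-(2H+1)},$$ $$g=f_H/f_H^*\ \ (g(0)=1),\qquad G_j=\int_{-1/2}^{1/2}g(x)\cos(2\pi jx)\,dx .$$ Here $f_H^*$ is the spectral density of the fractional Gaussian noise with variance $\mathcal V$, whose variance time function is $\mathcal V n^{2H}$ and whose correlation time function is $n^{2H}$. Then there is a real constant $D$ such that: 1. for every integer $n\ge1$, as $m\to\infty$, $$\varphi_H^{(m)}(n)=n^{2H}+D\,(1-n^{2H})\,m^{-2H}+o(m^{-2H})=n^{2H}+O(m^{-2H});$$ 2. $\omega_H(n)=\mathcal V n^{2H}+\mathcal V D+o(1)$ as $n\to\infty$ (so $D$ is the additive constant between the variance time functions of $X$ and of its fGn limit, relative to $\mathcal V$); 3. $D=-2\sum_{j=1}^\infty j^{2H}G_j$ whenever $\sum_{j\ge1} j^{2H}|G_j|<\infty$, and this sum is finite whenever the $1$-periodic extension of $h$ from $[-1/2,1/2]$ is three times continuously differentiable on $\mathbb R$. -/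

import Mathlib

open MeasureTheory ProbabilityTheory Filter Topology Asymptotics

noncomputable section

namespace FracDiff

/-! ### Second-order structure of a discrete time process -/

/-- A real discrete time process `Y` is second-order stationary: square integrable, with constant
mean, constant positive variance, and autocovariances that depend only on the lag. -/
structure IsSecondOrderStationary {Ω : Type*} [MeasurableSpace Ω] (μ : Measure Ω)
    (Y : ℤ → Ω → ℝ) : Prop where
  memLp : ∀ t, MemLp (Y t) 2 μ
  mean_eq : ∀ s t, ∫ w, Y s w ∂μ = ∫ w, Y t w ∂μ
  variance_pos : ∀ t, 0 < variance (Y t) μ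
  covariance_eq : ∀ s t k, covariance (Y s) (Y (s + k)) μ = covariance (Y t) (Y (t + k)) μ

/-- Autocovariance function `γ(k) = E[(X(0) - E X(0)) (X(k) - E X(k))]`. -/
def acvf {Ω : Type*} [MeasurableSpace Ω] (μ : Measure Ω) (X : ℤ → Ω → ℝ) (k : ℤ) : ℝ :=
  covariance (X 0) (X k) μ

/-- The double integration operator on sequences,
`(I a)(n) = ∑_{k=0}^{n-1} ∑_{i=-k}^{k} a(i)`. -/
def doubleSum (a : ℤ → ℝ) (n : ℕ) : ℝ :=
  ∑ k ∈ Finset.range n, ∑ i ∈ Finset.Icc (-(k : ℤ)) (k : ℤ), a i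

/-- Variance time function `ω = I γ`. -/
def vtf {Ω : Type*} [MeasurableSpace Ω] (μ : Measure Ω) (X : ℤ → Ω → ℝ) (n : ℕ) : ℝ :=
  doubleSum (acvf μ X) n

/-- Correlation time function `φ(n) = ω(n) / ω(1)`. -/
def ctf {Ω : Type*} [MeasurableSpace Ω] (μ : Measure Ω) (X : ℤ → Ω → ℝ) (n : ℕ) : ℝ :=
  vtf μ X n / vtf μ X 1

/-- Aggregation of level `m`: `X^{(m)}(t) = (1/m) ∑_{j=m(t-1)+1}^{mt} X(j)`. -/
def aggregate {Ω : Type*} (X : ℤ → Ω → ℝ) (m : ℕ) (t : ℤ) (w : Ω) : ℝ :=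
  (1 / (m : ℝ)) * ∑ j ∈ Finset.Icc ((m : ℤ) * (t - 1) + 1) ((m : ℤ) * t), X j w

/-- `h` is the spectral density of `Y`, in normalised frequency: `h` is nonnegative and integrable
on `[-1/2, 1/2]` and `Cov(Y(s), Y(t)) = ∫_{-1/2}^{1/2} h(x) e^{2πi(t-s)x} dx`.
For a real process this forces `h` to be even almost everywhere. -/
structure HasSpectralDensity {Ω : Type*} [MeasurableSpace Ω] (μ : Measure Ω)
    (Y : ℤ → Ω → ℝ) (h : ℝ → ℝ) : Prop where
  nonneg : ∀ x ∈ Set.Icc (-(1 / 2) : ℝ) (1 / 2), 0 ≤ h x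
  integrable : IntervalIntegrable h volume (-(1 / 2) : ℝ) (1 / 2)
  covariance_eq : ∀ s t : ℤ, ((covariance (Y s) (Y t) μ : ℝ) : ℂ) =
    ∫ x in (-(1 / 2) : ℝ)..(1 / 2),
      (h x : ℂ) * Complex.exp (2 * Real.pi * Complex.I * ((t : ℂ) - (s : ℂ)) * (x : ℂ))

/-! ### Fractional differencing -/

/-- Coefficient of `B^j` in `(1 - B)^δ`, for `δ` not a natural number. -/
def fracDiffCoeff (δ : ℝ) (j : ℕ) : ℝ :=
  Real.Gamma (j - δ) / (Real.Gamma (-δ) * Real.Gamma (j + 1))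

/-- `X = (1 - B)^δ Y`: each `X(t)` is the mean square limit of the partial sums of
`∑_{j ≥ 0} fracDiffCoeff δ j * Y(t - j)`. -/
structure IsFracDiff {Ω : Type*} [MeasurableSpace Ω] (μ : Measure Ω) (δ : ℝ)
    (Y X : ℤ → Ω → ℝ) : Prop where
  memLp : ∀ t, MemLp (X t) 2 μ
  tendsto : ∀ t, Tendsto
    (fun N : ℕ => eLpNorm
      (fun w => X t w - ∑ j ∈ Finset.range N, fracDiffCoeff δ j * Y (t - (j : ℤ)) w) 2 μ)
    atTop (𝓝 0)

/-- The spectral density `f_H(x) = h(x) |2 sin πx|^{-(2H-1)}`. -/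
def fracSpectralDensity (H : ℝ) (h : ℝ → ℝ) (x : ℝ) : ℝ :=
  h x * |2 * Real.sin (Real.pi * x)| ^ (-(2 * H - 1))

/-- The prefactor `c_f = (2π)^{1-2H} h(0)` of `f_H` at the origin. -/
def fracPrefactor (H : ℝ) (h : ℝ → ℝ) : ℝ :=
  (2 * Real.pi) ^ (1 - 2 * H) * h 0

/-! ### Fractional Gaussian noise -/

/-- `C(H) = π⁻¹ H Γ(2H) sin(πH)`. -/
def fgnConst (H : ℝ) : ℝ :=
  Real.pi⁻¹ * H * Real.Gamma (2 * H) * Real.sin (H * Real.pi)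

/-- The spectral density `f*_H` of the fGn whose prefactor at the origin is `c`. -/
def fgnSpectralDensity (H c x : ℝ) : ℝ :=
  c * (Real.pi ^ 2)⁻¹ * (2 * Real.pi) ^ (2 * H + 1) * Real.sin (Real.pi * x) ^ 2 *
    ∑' j : ℤ, |2 * Real.pi * (j : ℝ) + 2 * Real.pi * x| ^ (-(2 * H + 1))

/-- The variance `V` of the fGn whose prefactor at the origin is `c`, that is the solution of
`c = V (2π)^{2-2H} C(H)`. -/
def fgnVariance (H c : ℝ) : ℝ :=
  c / ((2 * Real.pi) ^ (2 - 2 * H) * fgnConst H)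

/-- The VTF `ω*_{H,V}(n) = V n^{2H}` of fGn. -/
def fgnVTF (H V : ℝ) (n : ℕ) : ℝ := V * (n : ℝ) ^ (2 * H)

/-- The CTF `φ*_H(n) = n^{2H}` of fGn. -/
def fgnCTF (H : ℝ) (n : ℕ) : ℝ := (n : ℝ) ^ (2 * H)

/-! ### The spectral ratio and its Fourier coefficients -/

/-- The ratio `g = f_H / f*_H`, for the fGn with the same prefactor at the origin (so that
`g(0) := lim_{x → 0} g(x) = 1`). -/
def spectralRatio (H : ℝ) (h : ℝ → ℝ) (x : ℝ) : ℝ :=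
  if x = 0 then 1 else
    fracSpectralDensity H h x / fgnSpectralDensity H (fracPrefactor H h) x

/-- The Fourier coefficients `G_j = ∫_{-1/2}^{1/2} g(x) e^{-2πijx} dx` of the even function `g`. -/
def ratioCoeff (H : ℝ) (h : ℝ → ℝ) (j : ℕ) : ℝ :=
  ∫ x in (-(1 / 2) : ℝ)..(1 / 2), spectralRatio H h x * Real.cos (2 * Real.pi * (j : ℝ) * x)

end FracDiff

end

/-!
Summing the covariances of a process `X` with spectral density `f` gives
`ω(n) = ∫ f(x) sin²(πnx) / sin²(πx) dx`. For fractional Gaussian noise, `f(x) / sin²(πx)` is a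
multiple of the periodised kernel `K(x) = ∑ |k + x|^{-(2H+1)}`, and unfolding the periodisation
gives `∫ K(x) sin²(πnx) dx = ∫_ℝ |x|^{-(2H+1)} sin²(πnx) dx`, a multiple of `n^{2H}`. As
`f_H = g f*_H`, the difference `ω(n) - V n^{2H}` is a multiple of `∫ K(x) (g(x) - 1) sin²(πnx) dx`.
Once `h` is replaced by its even part, which is a spectral density of the same process,
`g - 1 = O(x²)`; so `K (g - 1)` is integrable, and the Riemann–Lebesgue lemma, applied after writing
`sin² = (1 - cos) / 2`, yields the limit `V D`. The correlation time functions follow because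
`φ^{(m)}(n) = ω(nm) / ω(m)`.

Integrating the cosine series of `g` termwise against `K` gives `D = -2 ∑ j^{2H} G_j`. If the
periodic extension of `h` is `C³`, then `g` is `1`-periodic and `C²` with an integrable third
derivative, its only singularity being of type `|x|^{2H+1}`, so that three integrations by parts
give `G_j = O(j^{-3})`.
-/

namespace FracDiff

open Real Set

/-! ### The variance time function of fractional Gaussian noise -/

theorem integral_integral_swap_of_nonneg {α β : Type*} [MeasurableSpace α] [MeasurableSpace β]
    {μ : Measure α} {ν : Measure β} [SFinite μ] [SFinite ν] {f : α → β → ℝ}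
    (hf : AEStronglyMeasurable (Function.uncurry f) (μ.prod ν))
    (hf0 : ∀ᵐ y ∂ν, ∀ᵐ x ∂μ, 0 ≤ f x y) (hint : ∀ᵐ y ∂ν, Integrable (fun x => f x y) μ)
    (hint' : Integrable (fun y => ∫ x, f x y ∂μ) ν) :
    ∫ x, ∫ y, f x y ∂ν ∂μ = ∫ y, ∫ x, f x y ∂μ ∂ν := by
  refine integral_integral_swap ((integrable_prod_iff' hf).2 ⟨hint, hint'.congr ?_⟩)
  filter_upwards [hf0] with y hy
  refine integral_congr_ae ?_
  filter_upwards [hy] with x hx using (norm_of_nonneg hx).symm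

theorem integral_Ioi_integral_Ioi_swap_of_nonneg {f : ℝ → ℝ → ℝ}
    (hf : Measurable (Function.uncurry f)) (hf0 : ∀ x > 0, ∀ y > 0, 0 ≤ f x y)
    (hint : ∀ y > 0, IntegrableOn (fun x => f x y) (Ioi 0))
    (hint' : IntegrableOn (fun y => ∫ x in Ioi 0, f x y) (Ioi 0)) :
    ∫ x in Ioi 0, ∫ y in Ioi 0, f x y = ∫ y in Ioi 0, ∫ x in Ioi 0, f x y :=
  integral_integral_swap_of_nonneg hf.aestronglyMeasurable
    (ae_restrict_of_forall_mem measurableSet_Ioi fun y hy =>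
      ae_restrict_of_forall_mem measurableSet_Ioi fun x hx => hf0 x hx y hy)
    (ae_restrict_of_forall_mem measurableSet_Ioi hint) hint'

theorem sin_pi_mul_pos {x : ℝ} (h0 : 0 < x) (h1 : x < 1) : 0 < sin (π * x) :=
  sin_pos_of_pos_of_lt_pi (by positivity) (by nlinarith [pi_pos])

section SineIntegral

variable {s : ℝ}

theorem integral_rpow_mul_exp_neg_mul_one_add_sq (hs : 0 < s) {w : ℝ} (hw : 0 < w) :
    ∫ u in Ioi (0 : ℝ), u ^ (s - 1) * exp (-(w * (1 + u ^ 2)))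
      = Gamma (s / 2) / 2 * (w ^ ((1 - s / 2) - 1) * exp (-w)) := by
  have hexp (u : ℝ) : u ^ (s - 1) * exp (-(w * (1 + u ^ 2)))
      = exp (-w) * (u ^ (s - 1) * exp (-w * u ^ (2 : ℝ))) := by
    rw [show -(w * (1 + u ^ 2)) = -w + -w * u ^ (2 : ℝ) by norm_cast; ring, exp_add]
    ring
  simp_rw [hexp]
  rw [integral_const_mul, integral_rpow_mul_exp_neg_mul_rpow two_pos (by linarith) hw,
    show -(s - 1 + 1) / 2 = (1 - s / 2) - 1 by ring, sub_add_cancel]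
  ring

theorem integral_exp_neg_mul_Ioi {a : ℝ} (ha : 0 < a) :
    ∫ w in Ioi (0 : ℝ), exp (-(w * a)) = 1 / a := by
  have h := integral_exp_mul_Ioi (neg_neg_of_pos ha) 0
  simpa only [neg_mul, mul_comm a, mul_zero, exp_zero, neg_div_neg_eq, neg_zero] using h

-- Writing `1 / (1 + u²)` as a Laplace integral turns this into the reflection formula for `Γ`.
theorem integral_rpow_div_one_add_sq (hs0 : 0 < s) (hs2 : s < 2) :
    ∫ u in Ioi (0 : ℝ), u ^ (s - 1) / (1 + u ^ 2) = π / (2 * sin (π * (s / 2))) := by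
  have hsin := sin_pi_mul_pos (x := s / 2) (by linarith) (by linarith)
  have := Gamma_pos_of_pos (half_pos hs0)
  have hlaplace : ∀ u ∈ Ioi (0 : ℝ), ∫ w in Ioi (0 : ℝ), u ^ (s - 1) * exp (-(w * (1 + u ^ 2)))
      = u ^ (s - 1) / (1 + u ^ 2) := fun u _ => by
    rw [integral_const_mul, integral_exp_neg_mul_Ioi (by positivity), mul_one_div]
  have hgauss : ∀ w ∈ Ioi (0 : ℝ), ∫ u in Ioi (0 : ℝ), u ^ (s - 1) * exp (-(w * (1 + u ^ 2)))
      = Gamma (s / 2) / 2 * (w ^ ((1 - s / 2) - 1) * exp (-w)) :=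
    fun w hw => integral_rpow_mul_exp_neg_mul_one_add_sq hs0 hw
  have houter : ∫ w in Ioi (0 : ℝ), Gamma (s / 2) / 2 * (w ^ ((1 - s / 2) - 1) * exp (-w))
      = π / (2 * sin (π * (s / 2))) := by
    have h := integral_rpow_mul_exp_neg_mul_Ioi (a := 1 - s / 2) (by linarith) one_pos
    simp only [one_mul, div_one, one_rpow] at h
    rw [integral_const_mul, h, div_mul_eq_mul_div, Gamma_mul_Gamma_one_sub, div_div,
      mul_comm (sin _)]
  rw [← houter, ← setIntegral_congr_fun measurableSet_Ioi hgauss,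
    ← setIntegral_congr_fun measurableSet_Ioi hlaplace]
  refine integral_Ioi_integral_Ioi_swap_of_nonneg (by fun_prop) (fun u hu w _ => by positivity)
    (fun w hw => ?_) ?_ <;> apply Integrable.of_integral_ne_zero
  · rw [hgauss w hw]
    positivity
  · rw [setIntegral_congr_fun measurableSet_Ioi hgauss, houter]
    positivity

theorem hasDerivAt_primitive_one_sub_cos_mul_exp {u : ℝ} (hu : 0 < u) (t : ℝ) :
    HasDerivAt (fun t => exp (-(u * t)) * (-1 / u + (u * cos t - sin t) / (1 + u ^ 2)))
      ((1 - cos t) * exp (-(u * t))) t := by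
  have hexp : HasDerivAt (fun t => exp (-(u * t))) (exp (-(u * t)) * -(u * 1)) t :=
    ((hasDerivAt_id t).const_mul u).neg.exp
  have htrig : HasDerivAt (fun t => -1 / u + (u * cos t - sin t) / (1 + u ^ 2))
      ((u * -sin t - cos t) / (1 + u ^ 2)) t :=
    ((((hasDerivAt_cos t).const_mul u).sub (hasDerivAt_sin t)).div_const _).const_add _
  refine (hexp.mul htrig).congr_deriv ?_
  have : 1 + u ^ 2 ≠ 0 := by positivity
  field_simp
  ring

theorem integral_one_sub_cos_mul_exp {u : ℝ} (hu : 0 < u) :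
    ∫ t in Ioi (0 : ℝ), (1 - cos t) * exp (-(u * t)) = 1 / (u * (1 + u ^ 2)) := by
  have hexp : Tendsto (fun t => exp (-(u * t))) atTop (𝓝 0) :=
    tendsto_exp_neg_atTop_nhds_zero.comp (tendsto_id.const_mul_atTop hu)
  have hbounded (t : ℝ) : |-1 / u + (u * cos t - sin t) / (1 + u ^ 2)| ≤ 1 / u + (u + 1) := by
    have hnum : |u * cos t - sin t| ≤ u + 1 := by
      refine (abs_sub _ _).trans (add_le_add ?_ (abs_sin_le_one t))
      rw [abs_mul, abs_of_pos hu]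
      exact mul_le_of_le_one_right hu.le (abs_cos_le_one t)
    refine (abs_add_le _ _).trans (add_le_add ?_ ?_)
    · rw [abs_div, abs_neg, abs_one, abs_of_pos hu]
    · rw [abs_div, abs_of_pos (by positivity : 0 < 1 + u ^ 2)]
      exact (div_le_self (abs_nonneg _) (by nlinarith)).trans hnum
  have hlim : Tendsto (fun t => exp (-(u * t)) *
      (-1 / u + (u * cos t - sin t) / (1 + u ^ 2))) atTop (𝓝 0) :=
    hexp.zero_mul_isBoundedUnder_le (isBoundedUnder_of ⟨_, hbounded⟩)
  rw [integral_Ioi_of_hasDerivAt_of_nonneg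
    (hasDerivAt_primitive_one_sub_cos_mul_exp hu 0).continuousAt.continuousWithinAt
    (fun t _ => hasDerivAt_primitive_one_sub_cos_mul_exp hu t)
    (fun t _ => mul_nonneg (sub_nonneg.2 (cos_le_one t)) (exp_pos _).le) hlim]
  simp only [mul_zero, neg_zero, exp_zero, cos_zero, sin_zero, mul_one, sub_zero, one_mul]
  field_simp
  ring

theorem integral_one_sub_cos_mul_rpow (hs0 : 0 < s) (hs2 : s < 2) :
    ∫ t in Ioi (0 : ℝ), (1 - cos t) * t ^ (-(s + 1))
      = π / (2 * sin (π * (s / 2)) * Gamma (s + 1)) := by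
  have hsin := sin_pi_mul_pos (x := s / 2) (by linarith) (by linarith)
  have hGamma : 0 < Gamma (s + 1) := Gamma_pos_of_pos (by linarith)
  have hinner : ∀ u ∈ Ioi (0 : ℝ), ∫ t in Ioi (0 : ℝ), u ^ s * ((1 - cos t) * exp (-(u * t)))
      = u ^ (s - 1) / (1 + u ^ 2) := fun u (hu : 0 < u) => by
    rw [integral_const_mul, integral_one_sub_cos_mul_exp hu, rpow_sub_one hu.ne']
    field_simp
  have houter : ∀ t ∈ Ioi (0 : ℝ), ∫ u in Ioi (0 : ℝ), u ^ s * ((1 - cos t) * exp (-(u * t)))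
      = Gamma (s + 1) * ((1 - cos t) * t ^ (-(s + 1))) := fun t (ht : 0 < t) => by
    have hcomm (u : ℝ) : u ^ s * ((1 - cos t) * exp (-(u * t)))
        = (1 - cos t) * (u ^ ((s + 1) - 1) * exp (-(t * u))) := by
      rw [add_sub_cancel_right, mul_comm t u]
      ring
    simp_rw [hcomm]
    rw [integral_const_mul, integral_rpow_mul_exp_neg_mul_Ioi (by linarith) ht, rpow_neg ht.le,
      one_div, inv_rpow ht.le]
    ring
  have hswap := integral_Ioi_integral_Ioi_swap_of_nonneg
    (f := fun t u : ℝ => u ^ s * ((1 - cos t) * exp (-(u * t)))) (by fun_prop)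
    (fun t _ u hu => mul_nonneg (rpow_nonneg hu.le _)
      (mul_nonneg (sub_nonneg.2 (cos_le_one t)) (exp_pos _).le))
    (fun u hu => Integrable.of_integral_ne_zero (by rw [hinner u hu]; positivity))
    (Integrable.of_integral_ne_zero (by
      rw [setIntegral_congr_fun measurableSet_Ioi hinner, integral_rpow_div_one_add_sq hs0 hs2]
      positivity))
  rw [setIntegral_congr_fun measurableSet_Ioi houter,
    setIntegral_congr_fun measurableSet_Ioi hinner, integral_const_mul,
    integral_rpow_div_one_add_sq hs0 hs2] at hswap
  rw [← div_div, eq_div_iff hGamma.ne', mul_comm, hswap]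

/-- The constant `∫ |x|^{-(s+1)} sin²(πx) dx`, which governs the variance of fractional Gaussian
noise when `s = 2H`. -/
noncomputable def sineIntegral (s : ℝ) : ℝ := ∫ x : ℝ, |x| ^ (-(s + 1)) * sin (π * x) ^ 2

theorem sineIntegral_eq (hs0 : 0 < s) (hs2 : s < 2) :
    sineIntegral s = (2 * π) ^ s * (π / (2 * sin (π * (s / 2)) * Gamma (s + 1))) := by
  have habs (x : ℝ) : |x| ^ (-(s + 1)) * sin (π * x) ^ 2
      = |x| ^ (-(s + 1)) * sin (π * |x|) ^ 2 := by
    rcases abs_choice x with h | h <;> simp [h]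
  have hdouble : ∀ x ∈ Ioi (0 : ℝ), x ^ (-(s + 1)) * sin (π * x) ^ 2
      = (2 * π) ^ (s + 1) / 2 * ((1 - cos (2 * π * x)) * (2 * π * x) ^ (-(s + 1))) := by
    intro x hx
    rw [mul_rpow two_pi_pos.le (le_of_lt hx), rpow_neg two_pi_pos.le, sin_sq_eq_half_sub,
      ← mul_assoc 2 π x]
    have := (rpow_pos_of_pos two_pi_pos (s + 1)).ne'
    field_simp
  unfold sineIntegral
  simp_rw [habs]
  rw [integral_comp_abs (f := fun x => x ^ (-(s + 1)) * sin (π * x) ^ 2),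
    setIntegral_congr_fun measurableSet_Ioi hdouble, integral_const_mul,
    integral_comp_mul_left_Ioi (fun t => (1 - cos t) * t ^ (-(s + 1))) 0 two_pi_pos, mul_zero,
    integral_one_sub_cos_mul_rpow hs0 hs2, smul_eq_mul, rpow_add_one two_pi_pos.ne']
  field_simp

theorem sineIntegral_pos (hs0 : 0 < s) (hs2 : s < 2) : 0 < sineIntegral s := by
  have hsin := sin_pi_mul_pos (x := s / 2) (by linarith) (by linarith)
  have : 0 < Gamma (s + 1) := Gamma_pos_of_pos (by linarith)
  rw [sineIntegral_eq hs0 hs2]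
  positivity

theorem integral_abs_rpow_mul_sin_sq (s : ℝ) {a : ℝ} (ha : 0 < a) :
    ∫ x : ℝ, |x| ^ (-(s + 1)) * sin (π * a * x) ^ 2 = sineIntegral s * a ^ s := by
  have hscale (x : ℝ) : |x| ^ (-(s + 1)) * sin (π * a * x) ^ 2
      = a ^ (s + 1) * (|a * x| ^ (-(s + 1)) * sin (π * (a * x)) ^ 2) := by
    rw [abs_mul, abs_of_pos ha, mul_rpow ha.le (abs_nonneg x), rpow_neg ha.le, mul_assoc π]
    have := (rpow_pos_of_pos ha (s + 1)).ne'
    field_simp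
  simp_rw [hscale]
  rw [integral_const_mul, Measure.integral_comp_mul_left
    (fun x => |x| ^ (-(s + 1)) * sin (π * x) ^ 2), abs_of_pos (inv_pos.2 ha), smul_eq_mul,
    rpow_add_one ha.ne', sineIntegral]
  field_simp

theorem integrable_abs_rpow_mul_sin_sq (hs0 : 0 < s) (hs2 : s < 2) {a : ℝ} (ha : 0 < a) :
    Integrable fun x : ℝ => |x| ^ (-(s + 1)) * sin (π * a * x) ^ 2 := by
  apply Integrable.of_integral_ne_zero
  rw [integral_abs_rpow_mul_sin_sq s ha]
  exact (mul_pos (sineIntegral_pos hs0 hs2) (rpow_pos_of_pos ha s)).ne'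

theorem fgnVariance_eq {H : ℝ} (h0 : 0 < H) (h1 : H < 1) (c : ℝ) :
    fgnVariance H c = c * (π ^ 2)⁻¹ * sineIntegral (2 * H) := by
  have hsin := sin_pi_mul_pos h0 h1
  have : 0 < Gamma (2 * H) := Gamma_pos_of_pos (by linarith)
  rw [sineIntegral_eq (by linarith) (by linarith), mul_div_cancel_left₀ H two_ne_zero,
    fgnVariance, fgnConst, Gamma_add_one (by linarith), rpow_sub two_pi_pos, mul_comm H π]
  have := rpow_pos_of_pos two_pi_pos (2 * H)
  norm_cast
  field_simp

end SineIntegral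

/-- The 1-periodisation `K_b(x) = ∑_{k ∈ ℤ} |k + x|^{-b}`. Up to a constant factor,
`K_{2H+1}(x) sin²(πx)` is the spectral density of fractional Gaussian noise. -/
noncomputable def powKernel (b x : ℝ) : ℝ := ∑' k : ℤ, |(k : ℝ) + x| ^ (-b)

theorem sin_sq_mul_add_int (n : ℕ) (k : ℤ) (x : ℝ) :
    sin (π * n * (x + k)) ^ 2 = sin (π * n * x) ^ 2 := by
  rw [show π * n * (x + k) = π * n * x + ((n * k : ℤ) : ℝ) * π by push_cast; ring,
    sin_add_int_mul_pi, mul_pow, ← sq_abs ((-1 : ℝ) ^ _), abs_zpow]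
  simp

theorem hasSum_integral_comp_add_int {f : ℝ → ℝ} (hf : Integrable f) (a : ℝ) :
    HasSum (fun k : ℤ => ∫ x in a..a + 1, f (x + k)) (∫ x, f x) := by
  refine (hf.hasSum_intervalIntegral a).congr_fun fun k => ?_
  rw [intervalIntegral.integral_comp_add_right, add_right_comm]

theorem integral_tsum_comp_add_int {f : ℝ → ℝ} (hf : Integrable f) (hf0 : 0 ≤ f) (a : ℝ) :
    ∫ x in a..a + 1, ∑' k : ℤ, f (x + k) = ∫ x, f x := by
  have hsum := hasSum_integral_comp_add_int hf a
  simp only [intervalIntegral.integral_of_le (le_add_of_nonneg_right zero_le_one)] at hsum ⊢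
  refine HasSum.unique ?_ hsum
  refine hasSum_integral_of_summable_integral_norm
    (fun k => (hf.comp_add_right (k : ℝ)).integrableOn) ?_
  simpa only [norm_of_nonneg (hf0 _)] using hsum.summable

theorem integral_powKernel_mul_sin_sq {s : ℝ} (hs0 : 0 < s) (hs2 : s < 2) {n : ℕ} (hn : 0 < n) :
    ∫ x in (-(1 / 2) : ℝ)..(1 / 2), powKernel (s + 1) x * sin (π * n * x) ^ 2
      = sineIntegral s * (n : ℝ) ^ s := by
  have hn' : (0 : ℝ) < n := Nat.cast_pos.2 hn
  rw [← integral_abs_rpow_mul_sin_sq s hn', ← integral_tsum_comp_add_int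
    (integrable_abs_rpow_mul_sin_sq hs0 hs2 hn') (fun x => by positivity) (-(1 / 2)),
    show (-(1 / 2) + 1 : ℝ) = 1 / 2 by norm_num]
  refine intervalIntegral.integral_congr fun x _ => ?_
  simp only [powKernel, sin_sq_mul_add_int, tsum_mul_right, add_comm]

theorem intervalIntegrable_powKernel_mul_sin_sq {s : ℝ} (hs0 : 0 < s) (hs2 : s < 2) (n : ℕ) :
    IntervalIntegrable (fun x => powKernel (s + 1) x * sin (π * n * x) ^ 2) volume
      (-(1 / 2) : ℝ) (1 / 2) := by
  rcases n.eq_zero_or_pos with rfl | hn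
  · simp
  rw [intervalIntegrable_iff_integrableOn_Ioc_of_le (by norm_num)]
  apply Integrable.of_integral_ne_zero
  rw [← intervalIntegral.integral_of_le (by norm_num), integral_powKernel_mul_sin_sq hs0 hs2 hn]
  exact (mul_pos (sineIntegral_pos hs0 hs2) (rpow_pos_of_pos (Nat.cast_pos.2 hn) s)).ne'

/-! ### The binomial series of `(1 - z)^{-d}` on the unit circle -/

theorem norm_sum_Ico_mul_pow_le {a : ℕ → ℝ} (ha : Antitone a) (ha0 : ∀ j, 0 ≤ a j) {z : ℂ}
    (hz : ‖z‖ = 1) {M N : ℕ} (hMN : M ≤ N) :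
    ‖1 - z‖ * ‖∑ j ∈ Finset.Ico M N, (a j : ℂ) * z ^ j‖ ≤ 2 * a M := by
  have hparts : (1 - z) * ∑ j ∈ Finset.Ico M N, (a j : ℂ) * z ^ j
      = a M * z ^ M - a N * z ^ N
        - ∑ j ∈ Finset.Ico M N, ((a j - a (j + 1) : ℝ) : ℂ) * z ^ (j + 1) := by
    induction N, hMN using Nat.le_induction with
    | base => simp
    | succ N hN ih =>
      rw [Finset.sum_Ico_succ_top hN, Finset.sum_Ico_succ_top hN, mul_add, ih]
      push_cast
      ring
  have hterm {c : ℝ} (hc : 0 ≤ c) (j : ℕ) : ‖(c : ℂ) * z ^ j‖ = c := by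
    simp [hz, abs_of_nonneg hc]
  have hsum : ‖∑ j ∈ Finset.Ico M N, ((a j - a (j + 1) : ℝ) : ℂ) * z ^ (j + 1)‖ ≤ a M - a N := by
    refine (norm_sum_le _ _).trans_eq ?_
    rw [Finset.sum_congr rfl fun j _ => hterm (sub_nonneg.2 (ha j.le_succ)) (j + 1),
      Finset.sum_sub_distrib, ← neg_sub, ← Finset.sum_sub_distrib, Finset.sum_Ico_sub _ hMN,
      neg_sub]
  rw [← norm_mul, hparts]
  refine (norm_sub_le _ _).trans ?_
  refine (add_le_add (norm_sub_le _ _) hsum).trans_eq ?_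
  rw [hterm (ha0 M), hterm (ha0 N)]
  ring

theorem norm_sum_range_mul_pow_le {a : ℕ → ℝ} (ha : Antitone a) (ha0 : ∀ j, 0 ≤ a j) {z : ℂ}
    (hz : ‖z‖ = 1) (hz1 : z ≠ 1) (M N : ℕ) :
    ‖∑ j ∈ Finset.range N, (a j : ℂ) * z ^ j‖
      ≤ ∑ j ∈ Finset.range M, a j + 2 * a M / ‖1 - z‖ := by
  have hr : 0 < ‖1 - z‖ := norm_pos_iff.2 (sub_ne_zero.2 hz1.symm)
  have hnorm (K : ℕ) : ‖∑ j ∈ Finset.range K, (a j : ℂ) * z ^ j‖ ≤ ∑ j ∈ Finset.range K, a j :=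
    (norm_sum_le _ _).trans_eq (Finset.sum_congr rfl fun j _ => by
      simp [hz, abs_of_nonneg (ha0 j)])
  rcases le_total N M with hNM | hMN
  · refine (hnorm N).trans (le_add_of_le_of_nonneg ?_ ?_)
    · exact Finset.sum_le_sum_of_subset_of_nonneg (Finset.range_mono hNM) fun j _ _ => ha0 j
    · have := ha0 M
      positivity
  · rw [← Finset.sum_range_add_sum_Ico _ hMN]
    refine (norm_add_le _ _).trans (add_le_add (hnorm M) ?_)
    rw [le_div_iff₀' hr]
    exact norm_sum_Ico_mul_pow_le ha ha0 hz hMN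

theorem norm_geom_sum_le {z : ℂ} (hz : ‖z‖ = 1) (hz1 : z ≠ 1) (N : ℕ) :
    ‖∑ j ∈ Finset.range N, z ^ j‖ ≤ 2 / ‖1 - z‖ := by
  rw [geom_sum_eq hz1, norm_div, norm_sub_rev z]
  gcongr
  refine (norm_sub_le _ _).trans_eq ?_
  rw [norm_pow, hz, one_pow, norm_one, one_add_one_eq_two]

theorem one_sub_div_le_rpow_neg {x p : ℝ} (hx : 0 < x) (hp0 : 0 ≤ p) (hp1 : p ≤ 1) :
    1 - p / x ≤ (1 + 1 / x) ^ (-p) := by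
  have hpos : 0 < 1 + 1 / x := by positivity
  have hbernoulli : (1 + 1 / x) ^ p ≤ 1 + p / x := by
    have hx' : -1 ≤ 1 / x := by linarith
    simpa only [mul_one_div] using rpow_one_add_le_one_add_mul_self hx' hp0 hp1
  calc 1 - p / x ≤ (1 + p / x)⁻¹ := by
        rw [← one_div, le_div_iff₀ (by positivity)]
        nlinarith [sq_nonneg (p / x)]
    _ ≤ ((1 + 1 / x) ^ p)⁻¹ := inv_anti₀ (rpow_pos_of_pos hpos p) hbernoulli
    _ = (1 + 1 / x) ^ (-p) := (rpow_neg hpos.le p).symm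

section Coeff

variable {d : ℝ}

theorem fracDiffCoeff_neg_zero (hd : 0 < d) : fracDiffCoeff (-d) 0 = 1 := by
  simp [fracDiffCoeff, (Gamma_pos_of_pos hd).ne']

theorem fracDiffCoeff_neg_succ (hd : 0 < d) (j : ℕ) :
    fracDiffCoeff (-d) (j + 1) = (j + d) / (j + 1) * fracDiffCoeff (-d) j := by
  have hj : (0 : ℝ) < j + 1 := by positivity
  have hd' := (Gamma_pos_of_pos hd).ne'
  have hj' := (Gamma_pos_of_pos hj).ne'
  unfold fracDiffCoeff
  push_cast
  rw [neg_neg, sub_neg_eq_add, sub_neg_eq_add, add_right_comm,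
    Gamma_add_one (by positivity : (j : ℝ) + d ≠ 0), Gamma_add_one hj.ne']
  field_simp

theorem fracDiffCoeff_neg_pos (hd : 0 < d) (j : ℕ) : 0 < fracDiffCoeff (-d) j := by
  rw [fracDiffCoeff, neg_neg, sub_neg_eq_add]
  have := Gamma_pos_of_pos hd
  have := Gamma_pos_of_pos (by positivity : 0 < (j : ℝ) + d)
  have := Gamma_pos_of_pos (by positivity : 0 < (j : ℝ) + 1)
  positivity

theorem antitone_fracDiffCoeff_neg (hd : 0 < d) (hd1 : d ≤ 1) : Antitone (fracDiffCoeff (-d)) := by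
  refine antitone_nat_of_succ_le fun j => ?_
  rw [fracDiffCoeff_neg_succ hd]
  refine mul_le_of_le_one_left (fracDiffCoeff_neg_pos hd j).le ?_
  exact (div_le_one (by positivity)).2 (by linarith)

theorem fracDiffCoeff_neg_le (hd : 0 < d) (hd1 : d ≤ 1) (j : ℕ) :
    fracDiffCoeff (-d) j ≤ ((j : ℝ) + 1) ^ (d - 1) := by
  induction j with
  | zero => simp [fracDiffCoeff_neg_zero hd]
  | succ j ih =>
    have hj : (0 : ℝ) < j + 1 := by positivity
    have hratio : ((j : ℝ) + d) / (j + 1) ≤ (1 + 1 / ((j : ℝ) + 1)) ^ (d - 1) := by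
      have h := one_sub_div_le_rpow_neg hj (sub_nonneg.2 hd1) (by linarith)
      rw [neg_sub] at h
      refine (le_of_eq ?_).trans h
      field_simp
      ring
    have hsplit : ((j + 1 : ℕ) : ℝ) + 1 = (1 + 1 / ((j : ℝ) + 1)) * (j + 1) := by
      push_cast
      field_simp
    rw [fracDiffCoeff_neg_succ hd, hsplit, mul_rpow (by positivity) hj.le]
    exact mul_le_mul hratio ih (fracDiffCoeff_neg_pos hd j).le (by positivity)

theorem mul_sum_fracDiffCoeff_neg (hd : 0 < d) (N : ℕ) :
    d * ∑ j ∈ Finset.range N, fracDiffCoeff (-d) j = N * fracDiffCoeff (-d) N := by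
  induction N with
  | zero => simp
  | succ N ih =>
    rw [Finset.sum_range_succ, mul_add, ih, fracDiffCoeff_neg_succ hd]
    push_cast
    field_simp

theorem sum_fracDiffCoeff_neg_le (hd : 0 < d) (hd1 : d ≤ 1) (N : ℕ) :
    ∑ j ∈ Finset.range N, fracDiffCoeff (-d) j ≤ (N : ℝ) ^ d / d := by
  rw [le_div_iff₀' hd, mul_sum_fracDiffCoeff_neg hd]
  rcases N.eq_zero_or_pos with rfl | hN
  · simp [zero_rpow hd.ne']
  have hN' : (0 : ℝ) < N := Nat.cast_pos.2 hN
  calc (N : ℝ) * fracDiffCoeff (-d) N ≤ N * (N : ℝ) ^ (d - 1) := by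
        gcongr
        exact (fracDiffCoeff_neg_le hd hd1 N).trans
          (rpow_le_rpow_of_nonpos hN' (by linarith) (by linarith))
    _ = (N : ℝ) ^ d := by rw [mul_comm, rpow_sub_one hN'.ne', div_mul_cancel₀ _ hN'.ne']

theorem tendsto_fracDiffCoeff_neg (hd : 0 < d) (hd1 : d < 1) :
    Tendsto (fracDiffCoeff (-d)) atTop (𝓝 0) := by
  have h : Tendsto (fun j : ℕ => ((j : ℝ) + 1) ^ (-(1 - d))) atTop (𝓝 0) :=
    (tendsto_rpow_neg_atTop (sub_pos.2 hd1)).comp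
      (tendsto_atTop_add_const_right _ _ tendsto_natCast_atTop_atTop)
  simp only [neg_sub] at h
  exact squeeze_zero (fun j => (fracDiffCoeff_neg_pos hd j).le)
    (fracDiffCoeff_neg_le hd hd1.le) h

/-- Partial sums of the binomial series of `(1 - z)^{-d}`; at `z = e^{-2πix}` this is the transfer
function of the truncated fractional filter. -/
noncomputable def binomialPartialSum (d : ℝ) (N : ℕ) (z : ℂ) : ℂ :=
  ∑ j ∈ Finset.range N, (fracDiffCoeff (-d) j : ℂ) * z ^ j

theorem norm_binomialPartialSum_le (hd : 0 < d) (hd1 : d ≤ 1) {z : ℂ} (hz : ‖z‖ = 1)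
    (hz1 : z ≠ 1) (N : ℕ) :
    ‖binomialPartialSum d N z‖ ≤ (1 / d + 2) * ‖1 - z‖ ^ (-d) := by
  have hr : 0 < ‖1 - z‖ := norm_pos_iff.2 (sub_ne_zero.2 hz1.symm)
  set r := ‖1 - z‖
  have hr' : 0 < 1 / r := one_div_pos.2 hr
  have hinv (p : ℝ) : (1 / r) ^ p = r ^ (-p) := by rw [one_div, inv_rpow hr.le, rpow_neg hr.le]
  -- The head and the tail of the sum balance when it is split at the index `1 / r`.
  set M := ⌊1 / r⌋₊
  have hhead : ∑ j ∈ Finset.range M, fracDiffCoeff (-d) j ≤ 1 / d * r ^ (-d) := by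
    refine (sum_fracDiffCoeff_neg_le hd hd1 M).trans ?_
    rw [← hinv, one_div_mul_eq_div]
    gcongr
    exact Nat.floor_le hr'.le
  have htail : 2 * fracDiffCoeff (-d) M / r ≤ 2 * r ^ (-d) := by
    have hM : fracDiffCoeff (-d) M ≤ r ^ (-d) * r := by
      refine (fracDiffCoeff_neg_le hd hd1 M).trans ?_
      rw [← rpow_add_one hr.ne', neg_add_eq_sub, ← neg_sub d 1, ← hinv]
      exact rpow_le_rpow_of_nonpos hr' (Nat.lt_floor_add_one _).le (by linarith)
    rw [div_le_iff₀ hr]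
    linarith
  rw [add_mul]
  exact (norm_sum_range_mul_pow_le (antitone_fracDiffCoeff_neg hd hd1)
    (fun j => (fracDiffCoeff_neg_pos hd j).le) hz hz1 M N).trans (add_le_add hhead htail)

theorem choose_eq_fracDiffCoeff_neg (hd : 0 < d) (n : ℕ) :
    Ring.choose ((d : ℂ) + n - 1) n = (fracDiffCoeff (-d) n : ℂ) := by
  have hne (k : ℕ) : (d : ℂ) ≠ -k := by
    rw [← Complex.ofReal_natCast, ← Complex.ofReal_neg, Ne, Complex.ofReal_inj]
    have := k.cast_nonneg (α := ℝ)
    linarith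
  have hpoch := Ring.factorial_nsmul_multichoose_eq_ascPochhammer (d : ℂ) n
  rw [Polynomial.ascPochhammer_smeval_eq_eval, ← Complex.Gamma_add_nat_div_Gamma_eq _ hne,
    nsmul_eq_mul] at hpoch
  rw [Ring.choose, show (d : ℂ) + n - 1 - n + 1 = d by ring, fracDiffCoeff, neg_neg,
    sub_neg_eq_add, Gamma_nat_eq_factorial, ← div_div]
  push_cast
  rw [← Complex.Gamma_ofReal, ← Complex.Gamma_ofReal, eq_div_iff (by exact_mod_cast
    n.factorial_ne_zero), mul_comm, hpoch, Complex.ofReal_add, Complex.ofReal_natCast, add_comm]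

theorem hasSum_fracDiffCoeff_neg_mul_pow (hd : 0 < d) {z : ℂ} (hz : ‖z‖ < 1) :
    HasSum (fun n => (fracDiffCoeff (-d) n : ℂ) * z ^ n) (1 / (1 - z) ^ (d : ℂ)) := by
  have hmem : z ∈ Metric.eball (0 : ℂ) 1 := by
    rw [mem_eball_zero_iff, ← ofReal_norm]
    exact ENNReal.ofReal_lt_one.2 hz
  have h := (Complex.one_div_one_sub_cpow_hasFPowerSeriesOnBall_zero (d : ℂ)).hasSum hmem
  rw [zero_add] at h
  refine h.congr_fun fun n => ?_
  rw [FormalMultilinearSeries.ofScalars_apply_eq, choose_eq_fracDiffCoeff_neg hd, smul_eq_mul]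

theorem re_one_sub_pos {z : ℂ} (hz : ‖z‖ = 1) (hz1 : z ≠ 1) : 0 < (1 - z).re := by
  rw [Complex.sub_re, Complex.one_re, sub_pos]
  refine ((Complex.re_le_norm z).trans_eq hz).lt_of_ne fun hre => hz1 ?_
  have him : z.im ^ 2 = 0 := by
    have h := Complex.sq_norm_sub_sq_re z
    rw [hz, hre] at h
    linarith
  exact Complex.ext hre (pow_eq_zero_iff two_ne_zero |>.1 him)

theorem tendsto_one_div_one_sub_ofReal_mul_cpow (d : ℂ) {z : ℂ} (hz : ‖z‖ = 1) (hz1 : z ≠ 1) :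
    Tendsto (fun r : ℝ => 1 / (1 - (r : ℂ) * z) ^ d) (𝓝[<] 1) (𝓝 (1 / (1 - z) ^ d)) := by
  have hcont : ContinuousAt (fun r : ℝ => 1 / (1 - (r : ℂ) * z) ^ d) 1 := by
    refine continuousAt_const.div (.cpow (by fun_prop) continuousAt_const ?_) ?_
    · exact Or.inl (by simpa using re_one_sub_pos hz hz1)
    · rw [Complex.ofReal_one, one_mul, Ne, Complex.cpow_eq_zero_iff, not_and_or]
      exact Or.inl (sub_ne_zero.2 hz1.symm)
  simpa using hcont.tendsto.mono_left nhdsWithin_le_nhds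

theorem cauchySeq_binomialPartialSum (hd : 0 < d) (hd1 : d < 1) {z : ℂ} (hz : ‖z‖ = 1)
    (hz1 : z ≠ 1) : CauchySeq fun N => binomialPartialSum d N z :=
  (antitone_fracDiffCoeff_neg hd hd1.le).cauchySeq_series_mul_of_tendsto_zero_of_bounded
    (tendsto_fracDiffCoeff_neg hd hd1) (norm_geom_sum_le hz hz1)

theorem tendsto_binomialPartialSum (hd : 0 < d) (hd1 : d < 1) {z : ℂ} (hz : ‖z‖ = 1)
    (hz1 : z ≠ 1) :
    Tendsto (fun N => binomialPartialSum d N z) atTop (𝓝 (1 / (1 - z) ^ (d : ℂ))) := by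
  obtain ⟨l, hl⟩ := cauchySeq_tendsto_of_complete (cauchySeq_binomialPartialSum hd hd1 hz hz1)
  have habel := Complex.tendsto_tsum_powerSeries_nhdsWithin_lt hl
  rw [tendsto_map'_iff] at habel
  have hsum : ∀ᶠ r : ℝ in 𝓝[<] 1, ∑' n, (fracDiffCoeff (-d) n : ℂ) * z ^ n * (r : ℂ) ^ n
      = 1 / (1 - (r : ℂ) * z) ^ (d : ℂ) := by
    filter_upwards [Ioo_mem_nhdsLT (zero_lt_one' ℝ)] with r hr
    have hrz : ‖(r : ℂ) * z‖ < 1 := by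
      rw [norm_mul, hz, mul_one, Complex.norm_real, norm_of_nonneg hr.1.le]
      exact hr.2
    rw [← (hasSum_fracDiffCoeff_neg_mul_pow hd hrz).tsum_eq]
    exact tsum_congr fun n => by ring
  rwa [tendsto_nhds_unique (habel.congr' hsum)
    (tendsto_one_div_one_sub_ofReal_mul_cpow d hz hz1)] at hl

theorem tendsto_norm_sq_binomialPartialSum (hd : 0 < d) (hd1 : d < 1) {z : ℂ} (hz : ‖z‖ = 1)
    (hz1 : z ≠ 1) :
    Tendsto (fun N => ‖binomialPartialSum d N z‖ ^ 2) atTop (𝓝 (‖1 - z‖ ^ (-(2 * d)))) := by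
  have h := (tendsto_binomialPartialSum hd hd1 hz hz1).norm.pow 2
  rwa [norm_div, norm_one, Complex.norm_cpow_real, div_pow, one_pow, one_div,
    ← rpow_mul_natCast (norm_nonneg _), ← rpow_neg (norm_nonneg _), Nat.cast_ofNat,
    mul_comm d] at h

end Coeff

/-! ### Spectral densities of filtered processes -/

theorem norm_one_sub_exp (x : ℝ) :
    ‖1 - Complex.exp ((2 * π * x : ℝ) * Complex.I)‖ = |2 * sin (π * x)| := by
  rw [norm_sub_rev, mul_comm, Complex.norm_exp_I_mul_ofReal_sub_one, Real.norm_eq_abs, mul_assoc,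
    mul_div_cancel_left₀ _ two_ne_zero]

theorem uIcc_half : uIcc (-(1 / 2) : ℝ) (1 / 2) = Icc (-(1 / 2)) (1 / 2) :=
  uIcc_of_le (by norm_num)

theorem mem_Icc_of_mem_uIoc_half {x : ℝ} (hx : x ∈ uIoc (-(1 / 2) : ℝ) (1 / 2)) :
    x ∈ Icc (-(1 / 2) : ℝ) (1 / 2) :=
  uIcc_half ▸ uIoc_subset_uIcc hx

theorem four_mul_abs_le_abs_two_mul_sin {x : ℝ} (hx : |x| ≤ 1 / 2) :
    4 * |x| ≤ |2 * sin (π * x)| := by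
  have hπ : |π * x| ≤ π / 2 := by
    rw [abs_mul, abs_of_pos pi_pos]
    nlinarith [pi_pos]
  have := mul_abs_le_abs_sin hπ
  rw [abs_mul, abs_of_pos pi_pos, ← mul_assoc, div_mul_cancel₀ _ pi_ne_zero] at this
  rw [abs_mul, abs_two]
  linarith

theorem sin_pi_mul_ne_zero {x : ℝ} (hx : |x| ≤ 1 / 2) (hx0 : x ≠ 0) : sin (π * x) ≠ 0 := by
  intro h
  have := four_mul_abs_le_abs_two_mul_sin hx
  rw [h, mul_zero, abs_zero] at this
  linarith [abs_pos.2 hx0]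

theorem exp_two_pi_mul_I_ne_one {x : ℝ} (hx : |x| ≤ 1 / 2) (hx0 : x ≠ 0) :
    Complex.exp ((2 * π * x : ℝ) * Complex.I) ≠ 1 := by
  rw [ne_comm, ← sub_ne_zero, ← norm_ne_zero_iff, norm_one_sub_exp]
  exact abs_ne_zero.2 (mul_ne_zero two_ne_zero (sin_pi_mul_ne_zero hx hx0))

theorem sum_sum_mul_zpow {z : ℂ} (hz : ‖z‖ = 1) (a : ℕ → ℝ) (N : ℕ) (s t : ℤ) :
    ∑ i ∈ Finset.range N, ∑ j ∈ Finset.range N,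
        ((a i * a j : ℝ) : ℂ) * z ^ ((t - j : ℤ) - (s - i : ℤ))
      = ((‖∑ j ∈ Finset.range N, (a j : ℂ) * z ^ j‖ ^ 2 : ℝ) : ℂ) * z ^ (t - s) := by
  have hz0 : z ≠ 0 := norm_ne_zero_iff.1 (hz.symm ▸ one_ne_zero)
  have hconj : (starRingEnd ℂ) z = z⁻¹ := by
    rw [Complex.inv_def, Complex.normSq_eq_norm_sq, hz]
    simp
  push_cast
  rw [← Complex.mul_conj', map_sum, Finset.sum_mul_sum, Finset.sum_mul]
  refine Finset.sum_congr rfl fun i _ => ?_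
  rw [Finset.sum_mul]
  refine Finset.sum_congr rfl fun j _ => ?_
  rw [map_mul, map_pow, hconj, Complex.conj_ofReal,
    show (t - j : ℤ) - (s - i : ℤ) = (i : ℤ) + (-(j : ℤ)) + (t - s) by ring, zpow_add₀ hz0,
    zpow_add₀ hz0, zpow_neg, zpow_natCast, zpow_natCast, inv_pow]
  ring

section SecondOrder

variable {Ω : Type*} [MeasurableSpace Ω] {μ : Measure Ω} {h : ℝ → ℝ} {X Y : ℤ → Ω → ℝ}

theorem intervalIntegrable_ofReal_mul_exp_zpow {a b : ℝ} (hh : IntervalIntegrable h volume a b)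
    (k : ℤ) : IntervalIntegrable
      (fun x => (h x : ℂ) * Complex.exp ((2 * π * x : ℝ) * Complex.I) ^ k) volume a b := by
  have hofReal : IntervalIntegrable (fun x => (h x : ℂ)) volume a b := ⟨hh.1.ofReal, hh.2.ofReal⟩
  refine hofReal.mul_continuousOn (Continuous.continuousOn ?_)
  simp only [← Complex.exp_int_mul]
  fun_prop

theorem exp_mul_eq_zpow (s t : ℤ) (x : ℝ) :
    Complex.exp (2 * π * Complex.I * ((t : ℂ) - (s : ℂ)) * (x : ℂ))
      = Complex.exp ((2 * π * x : ℝ) * Complex.I) ^ (t - s) := by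
  rw [← Complex.exp_int_mul]
  push_cast
  ring_nf

theorem HasSpectralDensity.covariance_eq_integral_zpow (hYh : HasSpectralDensity μ Y h)
    (s t : ℤ) : ((covariance (Y s) (Y t) μ : ℝ) : ℂ) = ∫ x in (-(1 / 2) : ℝ)..(1 / 2),
      (h x : ℂ) * Complex.exp ((2 * π * x : ℝ) * Complex.I) ^ (t - s) := by
  simp only [hYh.covariance_eq, exp_mul_eq_zpow]

theorem HasSpectralDensity.covariance_eq_integral_cos (hYh : HasSpectralDensity μ Y h)
    (s t : ℤ) : covariance (Y s) (Y t) μ = ∫ x in (-(1 / 2) : ℝ)..(1 / 2),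
      h x * cos (2 * (π * x) * (t - s : ℤ)) := by
  rw [← Complex.ofReal_re (covariance _ _ _), hYh.covariance_eq_integral_zpow,
    ← Complex.reCLM_apply, ← Complex.reCLM.intervalIntegral_comp_comm
      (intervalIntegrable_ofReal_mul_exp_zpow hYh.integrable _)]
  refine intervalIntegral.integral_congr fun x _ => ?_
  rw [Complex.reCLM_apply, Complex.re_ofReal_mul, ← Complex.exp_int_mul,
    show ((t - s : ℤ) : ℂ) * ((2 * π * x : ℝ) * Complex.I)
      = ((2 * (π * x) * (t - s : ℤ) : ℝ) : ℂ) * Complex.I by push_cast; ring,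
    Complex.exp_ofReal_mul_I_re]

theorem HasSpectralDensity.linearFilter [IsFiniteMeasure μ] (hY : ∀ t, MemLp (Y t) 2 μ)
    (hYh : HasSpectralDensity μ Y h) (a : ℕ → ℝ) (N : ℕ) :
    HasSpectralDensity μ (fun t w => ∑ j ∈ Finset.range N, a j * Y (t - (j : ℤ)) w)
      (fun x => h x * ‖∑ j ∈ Finset.range N,
        (a j : ℂ) * Complex.exp ((2 * π * x : ℝ) * Complex.I) ^ j‖ ^ 2) where
  nonneg x hx := mul_nonneg (hYh.nonneg x hx) (sq_nonneg _)
  integrable := hYh.integrable.mul_continuousOn (by fun_prop)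
  covariance_eq s t := by
    have hint (i j : ℕ) := (intervalIntegrable_ofReal_mul_exp_zpow hYh.integrable
      ((t - j) - (s - i))).const_mul ((a i * a j : ℝ) : ℂ)
    have hintegrand (x : ℝ) : ((h x * ‖∑ j ∈ Finset.range N,
          (a j : ℂ) * Complex.exp ((2 * π * x : ℝ) * Complex.I) ^ j‖ ^ 2 : ℝ) : ℂ)
          * Complex.exp (2 * π * Complex.I * ((t : ℂ) - (s : ℂ)) * (x : ℂ))
        = ∑ i ∈ Finset.range N, ∑ j ∈ Finset.range N, ((a i * a j : ℝ) : ℂ) * ((h x : ℂ)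
          * Complex.exp ((2 * π * x : ℝ) * Complex.I) ^ ((t - j : ℤ) - (s - i : ℤ))) := by
      rw [Complex.ofReal_mul, mul_assoc, exp_mul_eq_zpow,
        ← sum_sum_mul_zpow (Complex.norm_exp_ofReal_mul_I _)]
      simp only [Finset.mul_sum, mul_left_comm]
    rw [covariance_fun_sum_fun_sum' (fun j _ => (hY _).const_mul _)
      (fun j _ => (hY _).const_mul _)]
    simp only [hintegrand]
    rw [intervalIntegral.integral_finsetSum fun i _ => by
      simpa only [Finset.sum_fn] using IntervalIntegrable.sum _ fun j _ => hint i j]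
    rw [Complex.ofReal_sum]
    refine Finset.sum_congr rfl fun i _ => ?_
    rw [intervalIntegral.integral_finsetSum fun j _ => hint i j, Complex.ofReal_sum]
    refine Finset.sum_congr rfl fun j _ => ?_
    rw [covariance_const_mul_left, covariance_const_mul_right, intervalIntegral.integral_const_mul,
      Complex.ofReal_mul, Complex.ofReal_mul, hYh.covariance_eq_integral_zpow, ← mul_assoc,
      ← Complex.ofReal_mul]

/-! ### Mean square limits -/

theorem integral_mul_eq_inner_toLp {u v : Ω → ℝ} (hu : MemLp u 2 μ) (hv : MemLp v 2 μ) :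
    ∫ w, (u * v) w ∂μ = inner ℝ (hu.toLp u) (hv.toLp v) := by
  rw [L2.inner_def]
  refine integral_congr_ae ?_
  filter_upwards [hu.coeFn_toLp, hv.coeFn_toLp] with w huw hvw
  rw [huw, hvw, Pi.mul_apply, mul_comm]
  rfl

theorem covariance_eq_inner_toLp [IsProbabilityMeasure μ] {u v : Ω → ℝ} (hu : MemLp u 2 μ)
    (hv : MemLp v 2 μ) :
    covariance u v μ = inner ℝ (hu.toLp u) (hv.toLp v)
      - inner ℝ ((memLp_const (1 : ℝ)).toLp _) (hu.toLp u)
        * inner ℝ ((memLp_const (1 : ℝ)).toLp _) (hv.toLp v) := by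
  rw [covariance_eq_sub hu hv, ← integral_mul_eq_inner_toLp, ← integral_mul_eq_inner_toLp,
    ← integral_mul_eq_inner_toLp]
  simp only [Pi.mul_apply, one_mul]

theorem tendsto_toLp {u : Ω → ℝ} {U : ℕ → Ω → ℝ} (hU : ∀ N, MemLp (U N) 2 μ) (hu : MemLp u 2 μ)
    (hlim : Tendsto (fun N => eLpNorm (u - U N) 2 μ) atTop (𝓝 0)) :
    Tendsto (fun N => (hU N).toLp (U N)) atTop (𝓝 (hu.toLp u)) := by
  rw [Lp.tendsto_Lp_iff_tendsto_eLpNorm'']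
  simpa only [eLpNorm_sub_comm] using hlim

theorem tendsto_covariance [IsProbabilityMeasure μ] {U V : ℕ → Ω → ℝ} {u v : Ω → ℝ}
    (hU : ∀ N, MemLp (U N) 2 μ) (hV : ∀ N, MemLp (V N) 2 μ) (hu : MemLp u 2 μ) (hv : MemLp v 2 μ)
    (hUu : Tendsto (fun N => eLpNorm (u - U N) 2 μ) atTop (𝓝 0))
    (hVv : Tendsto (fun N => eLpNorm (v - V N) 2 μ) atTop (𝓝 0)) :
    Tendsto (fun N => covariance (U N) (V N) μ) atTop (𝓝 (covariance u v μ)) := by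
  have hUlim := tendsto_toLp hU hu hUu
  have hVlim := tendsto_toLp hV hv hVv
  simp only [covariance_eq_inner_toLp (hU _) (hV _), covariance_eq_inner_toLp hu hv]
  exact (hUlim.inner hVlim).sub
    ((tendsto_const_nhds.inner hUlim).mul (tendsto_const_nhds.inner hVlim))

theorem HasSpectralDensity.of_tendsto [IsProbabilityMeasure μ] {U : ℕ → ℤ → Ω → ℝ}
    {f : ℕ → ℝ → ℝ} {g bound : ℝ → ℝ} (hU : ∀ N t, MemLp (U N t) 2 μ) (hX : ∀ t, MemLp (X t) 2 μ)
    (hUX : ∀ t, Tendsto (fun N => eLpNorm (X t - U N t) 2 μ) atTop (𝓝 0))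
    (hUf : ∀ N, HasSpectralDensity μ (U N) (f N))
    (hg0 : ∀ x ∈ Icc (-(1 / 2) : ℝ) (1 / 2), 0 ≤ g x)
    (hg : IntervalIntegrable g volume (-(1 / 2)) (1 / 2))
    (hbound : IntervalIntegrable bound volume (-(1 / 2)) (1 / 2))
    (hfbound : ∀ N, ∀ᵐ x, x ∈ uIoc (-(1 / 2) : ℝ) (1 / 2) → |f N x| ≤ bound x)
    (hfg : ∀ᵐ x, x ∈ uIoc (-(1 / 2) : ℝ) (1 / 2) → Tendsto (f · x) atTop (𝓝 (g x))) :
    HasSpectralDensity μ X g where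
  nonneg := hg0
  integrable := hg
  covariance_eq s t := by
    have hcov := (Complex.continuous_ofReal.tendsto _).comp
      (tendsto_covariance (hU · s) (hU · t) (hX s) (hX t) (hUX s) (hUX t))
    simp only [Function.comp_def, (hUf _).covariance_eq_integral_zpow] at hcov
    simp only [exp_mul_eq_zpow]
    refine tendsto_nhds_unique hcov
      (intervalIntegral.tendsto_integral_filter_of_dominated_convergence bound ?_ ?_ hbound ?_)
    · exact .of_forall fun N =>
        (intervalIntegrable_ofReal_mul_exp_zpow (hUf N).integrable _).def'.aestronglyMeasurable
    · refine .of_forall fun N => ?_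
      filter_upwards [hfbound N] with x hx hxI
      rw [norm_mul, norm_zpow, Complex.norm_exp_ofReal_mul_I, one_zpow, mul_one,
        Complex.norm_real]
      exact hx hxI
    · filter_upwards [hfg] with x hx hxI
      exact ((Complex.continuous_ofReal.tendsto _).comp (hx hxI)).mul_const _

theorem IsFracDiff.hasSpectralDensity [IsProbabilityMeasure μ] {H : ℝ} (hH : 1 / 2 < H)
    (hH1 : H < 3 / 2) (hY : ∀ t, MemLp (Y t) 2 μ) (hYh : HasSpectralDensity μ Y h)
    (hf : IntervalIntegrable (fracSpectralDensity H h) volume (-(1 / 2)) (1 / 2))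
    (hX : IsFracDiff μ (-(H - 1 / 2)) Y X) :
    HasSpectralDensity μ X (fracSpectralDensity H h) := by
  have hd : 0 < H - 1 / 2 := by linarith
  have hd1 : H - 1 / 2 < 1 := by linarith
  have hz (x : ℝ) : ‖Complex.exp ((2 * π * x : ℝ) * Complex.I)‖ = 1 :=
    Complex.norm_exp_ofReal_mul_I _
  refine .of_tendsto (bound := fun x => (1 / (H - 1 / 2) + 2) ^ 2 * fracSpectralDensity H h x)
    (fun N t => memLp_finsetSum _ fun j _ => (hY _).const_mul _) hX.memLp hX.tendsto
    (hYh.linearFilter hY (fracDiffCoeff (-(H - 1 / 2)))) (fun x hx => mul_nonneg (hYh.nonneg x hx)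
      (by positivity)) hf (hf.const_mul _) (fun N => ?_) ?_
  · filter_upwards [Measure.ae_ne volume 0] with x hx0 hxI
    have hx := mem_Icc_of_mem_uIoc_half hxI
    have hle := norm_binomialPartialSum_le hd hd1.le (hz x)
      (exp_two_pi_mul_I_ne_one (abs_le.2 hx) hx0) N
    have hsq := pow_le_pow_left₀ (norm_nonneg _) hle 2
    rw [norm_one_sub_exp, mul_pow, ← rpow_mul_natCast (abs_nonneg _)] at hsq
    rw [abs_of_nonneg (mul_nonneg (hYh.nonneg x hx) (sq_nonneg _)), fracSpectralDensity,
      mul_left_comm]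
    refine mul_le_mul_of_nonneg_left (hsq.trans_eq ?_) (hYh.nonneg x hx)
    push_cast
    ring_nf
  · filter_upwards [Measure.ae_ne volume 0] with x hx0 hxI
    have hlim := tendsto_norm_sq_binomialPartialSum hd hd1 (hz x)
      (exp_two_pi_mul_I_ne_one (abs_le.2 (mem_Icc_of_mem_uIoc_half hxI)) hx0)
    rw [norm_one_sub_exp, mul_sub, mul_one_div_cancel two_ne_zero] at hlim
    exact hlim.const_mul (h x)

end SecondOrder

/-! ### Variance time functions and aggregation -/

theorem sum_Icc_neg_succ (f : ℤ → ℝ) (k : ℕ) :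
    ∑ i ∈ Finset.Icc (-((k + 1 : ℕ) : ℤ)) ((k + 1 : ℕ) : ℤ), f i
      = ∑ i ∈ Finset.Icc (-(k : ℤ)) (k : ℤ), f i + (f (k + 1) + f (-(k + 1))) := by
  have hIcc : Finset.Icc (-((k + 1 : ℕ) : ℤ)) ((k + 1 : ℕ) : ℤ)
      = insert ((k : ℤ) + 1) (insert (-((k : ℤ) + 1)) (Finset.Icc (-(k : ℤ)) (k : ℤ))) := by
    ext i
    simp only [Finset.mem_Icc, Finset.mem_insert]
    omega
  rw [hIcc, Finset.sum_insert, Finset.sum_insert]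
  · ring
  · simp
  · simp only [Finset.mem_insert, Finset.mem_Icc]
    omega

theorem sum_Icc_neg_eq_sum_range (f : ℤ → ℝ) (k : ℕ) :
    ∑ i ∈ Finset.Icc (-(k : ℤ)) (k : ℤ), f i
      = f 0 + ∑ i ∈ Finset.range k, (f (i + 1) + f (-(i + 1))) := by
  induction k with
  | zero => simp
  | succ k ih => rw [sum_Icc_neg_succ, ih, Finset.sum_range_succ, add_assoc]

theorem sum_cos_mul_sin (k : ℕ) (y : ℝ) :
    (∑ i ∈ Finset.Icc (-(k : ℤ)) (k : ℤ), cos (2 * y * i)) * sin y = sin ((2 * k + 1) * y) := by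
  induction k with
  | zero => simp
  | succ k ih =>
    rw [sum_Icc_neg_succ, add_mul, ih]
    push_cast
    rw [mul_neg, cos_neg, show (2 * ((k : ℝ) + 1) + 1) * y = 2 * y * (k + 1) + y by ring,
      show (2 * (k : ℝ) + 1) * y = 2 * y * (k + 1) - y by ring, sin_add, sin_sub]
    ring

theorem doubleSum_cos_mul_sin_sq (n : ℕ) (y : ℝ) :
    doubleSum (fun k => cos (2 * y * k)) n * sin y ^ 2 = sin (n * y) ^ 2 := by
  unfold doubleSum
  induction n with
  | zero => simp
  | succ n ih =>
    rw [Finset.sum_range_succ, add_mul, ih, sq (sin y), ← mul_assoc, sum_cos_mul_sin]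
    push_cast
    rw [show (2 * (n : ℝ) + 1) * y = n * y + (n + 1) * y by ring,
      show sin y = sin ((n + 1) * y - n * y) by congr 1; ring, sin_add, sin_sub]
    linear_combination sin ((n + 1) * y) ^ 2 * sin_sq_add_cos_sq (n * y)
      - sin (n * y) ^ 2 * sin_sq_add_cos_sq (((n : ℝ) + 1) * y)

theorem doubleSum_integral {F : ℤ → ℝ → ℝ} {a b : ℝ}
    (hF : ∀ k, IntervalIntegrable (F k) volume a b) (n : ℕ) :
    doubleSum (fun k => ∫ x in a..b, F k x) n = ∫ x in a..b, doubleSum (fun k => F k x) n := by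
  unfold doubleSum
  rw [intervalIntegral.integral_finsetSum fun k _ => by
    simpa only [Finset.sum_fn] using IntervalIntegrable.sum _ fun i _ => hF i]
  exact Finset.sum_congr rfl fun k _ =>
    (intervalIntegral.integral_finsetSum fun i _ => hF i).symm

theorem doubleSum_eq_sum_sum (γ : ℤ → ℝ) (n : ℕ) :
    doubleSum γ n = ∑ i ∈ Finset.range n, ∑ j ∈ Finset.range n, γ (j - i) := by
  unfold doubleSum
  induction n with
  | zero => simp
  | succ n ih =>
    have hrow : ∑ i ∈ Finset.range n, γ (i - n) = ∑ i ∈ Finset.range n, γ (-(i + 1)) := by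
      rw [← Finset.sum_range_reflect]
      refine Finset.sum_congr rfl fun i hi => congrArg γ ?_
      have := Finset.mem_range.1 hi
      omega
    have hcol : ∑ i ∈ Finset.range n, γ (n - i) = ∑ i ∈ Finset.range n, γ (i + 1) := by
      rw [← Finset.sum_range_reflect]
      refine Finset.sum_congr rfl fun i hi => congrArg γ ?_
      have := Finset.mem_range.1 hi
      omega
    rw [Finset.sum_range_succ, ih, sum_Icc_neg_eq_sum_range, Finset.sum_add_distrib, ← hrow,
      ← hcol, Finset.sum_range_succ _ n]
    simp only [Finset.sum_range_succ, Finset.sum_add_distrib, sub_self]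
    ring

theorem sum_Icc_add_one_add (f : ℤ → ℝ) (m : ℕ) (c : ℤ) :
    ∑ j ∈ Finset.Icc (c + 1) (c + m), f j = ∑ i ∈ Finset.range m, f (c + 1 + i) := by
  symm
  refine Finset.sum_bij (fun i _ => c + 1 + (i : ℤ)) ?_ ?_ ?_ fun _ _ => rfl
  · intro i hi
    rw [Finset.mem_range] at hi
    rw [Finset.mem_Icc]
    omega
  · intro i _ j _ hij
    omega
  · intro j hj
    rw [Finset.mem_Icc] at hj
    exact ⟨(j - c - 1).toNat, by rw [Finset.mem_range]; omega, by omega⟩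

/-- `∫ f(x) sin²(πnx) / sin²(πx) dx`, the variance of a sum of `n` consecutive terms of a process
with spectral density `f`. -/
noncomputable def fejerIntegral (f : ℝ → ℝ) (n : ℕ) : ℝ :=
  ∫ x in (-(1 / 2) : ℝ)..(1 / 2), f x * (sin (π * n * x) ^ 2 / sin (π * x) ^ 2)

section SecondOrder

variable {Ω : Type*} [MeasurableSpace Ω] {μ : Measure Ω} {f : ℝ → ℝ} {X : ℤ → Ω → ℝ}

theorem vtf_eq_fejerIntegral (hX : HasSpectralDensity μ X f) (n : ℕ) :
    vtf μ X n = fejerIntegral f n := by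
  unfold vtf acvf fejerIntegral
  simp only [hX.covariance_eq_integral_cos, sub_zero]
  rw [doubleSum_integral fun k => hX.integrable.mul_continuousOn (by fun_prop)]
  refine intervalIntegral.integral_congr_ae ?_
  filter_upwards [Measure.ae_ne volume 0] with x hx0 hx
  have hsin := sin_pi_mul_ne_zero (abs_le.2 (mem_Icc_of_mem_uIoc_half hx)) hx0
  have hmul : doubleSum (fun k => f x * cos (2 * (π * x) * k)) n
      = f x * doubleSum (fun k => cos (2 * (π * x) * k)) n := by
    simp only [doubleSum, Finset.mul_sum]
  rw [hmul, mul_comm π n, mul_assoc (n : ℝ), ← doubleSum_cos_mul_sin_sq,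
    mul_div_cancel_right₀ _ (pow_ne_zero 2 hsin)]

theorem doubleSum_block (γ : ℤ → ℝ) (m n : ℕ) :
    doubleSum (fun k => ∑ i ∈ Finset.range m, ∑ j ∈ Finset.range m, γ (m * k + j - i)) n
      = doubleSum γ (n * m) := by
  have hblock (F : ℕ → ℝ) : ∑ p ∈ Finset.range (n * m), F p
      = ∑ b ∈ Finset.range n, ∑ i ∈ Finset.range m, F (m * b + i) := by
    induction n with
    | zero => simp
    | succ n ih => rw [Nat.succ_mul, Finset.sum_range_add, ih, Finset.sum_range_succ, mul_comm n]
  simp only [doubleSum_eq_sum_sum, hblock]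
  refine Finset.sum_congr rfl fun b _ => ?_
  rw [Finset.sum_comm]
  refine Finset.sum_congr rfl fun i _ => Finset.sum_congr rfl fun c _ =>
    Finset.sum_congr rfl fun j _ => congrArg γ ?_
  push_cast
  ring

theorem acvf_aggregate [IsFiniteMeasure μ] (hX : ∀ t, MemLp (X t) 2 μ)
    (hcov : ∀ s t, covariance (X s) (X t) μ = acvf μ X (t - s)) (m : ℕ) (k : ℤ) :
    acvf μ (aggregate X m) k = (1 / (m : ℝ)) ^ 2 *
      ∑ i ∈ Finset.range m, ∑ j ∈ Finset.range m, acvf μ X (m * k + j - i) := by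
  have hagg (t : ℤ) : aggregate X m t = fun w => (1 / (m : ℝ)) *
      ∑ i ∈ Finset.range m, X ((m : ℤ) * (t - 1) + 1 + i) w := by
    ext w
    rw [aggregate, ← sum_Icc_add_one_add (X · w), mul_sub_one, sub_add_cancel]
  rw [acvf, hagg, hagg, covariance_const_mul_left, covariance_const_mul_right,
    covariance_fun_sum_fun_sum' (fun j _ => hX _) (fun j _ => hX _), sq, mul_assoc]
  refine congrArg _ (congrArg _
    (Finset.sum_congr rfl fun i _ => Finset.sum_congr rfl fun j _ => ?_))
  rw [hcov]
  congr 1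
  ring

theorem ctf_aggregate [IsFiniteMeasure μ] (hX : ∀ t, MemLp (X t) 2 μ)
    (hcov : ∀ s t, covariance (X s) (X t) μ = acvf μ X (t - s)) {m : ℕ} (hm : m ≠ 0) (n : ℕ) :
    ctf μ (aggregate X m) n = vtf μ X (n * m) / vtf μ X m := by
  have hvtf (n : ℕ) : vtf μ (aggregate X m) n = (1 / (m : ℝ)) ^ 2 * vtf μ X (n * m) := by
    rw [vtf, funext (acvf_aggregate hX hcov m), vtf, ← doubleSum_block]
    simp only [doubleSum, Finset.mul_sum]
  rw [ctf, hvtf, hvtf, one_mul, mul_div_mul_left _ _ (by positivity)]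

theorem HasSpectralDensity.covariance_eq_acvf (hX : HasSpectralDensity μ X f) (s t : ℤ) :
    covariance (X s) (X t) μ = acvf μ X (t - s) := by
  simp only [acvf, hX.covariance_eq_integral_cos, sub_zero]

end SecondOrder

/-! ### The periodised power kernel near the origin -/

/-- The shifted zeta series `∑_{k ≥ 1} (k + x)^{-b}`, for `b > 1` and `x > -1`. -/
noncomputable def shiftZeta (b x : ℝ) : ℝ := ∑' k : ℕ, ((k : ℝ) + 1 + x) ^ (-b)

theorem natCast_add_one_add_pos {x : ℝ} (hx : -1 < x) (k : ℕ) : 0 < (k : ℝ) + 1 + x := by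
  linarith [k.cast_nonneg (α := ℝ)]

theorem summable_shiftZeta {b x : ℝ} (hb : 1 < b) (hx : -1 < x) :
    Summable fun k : ℕ => ((k : ℝ) + 1 + x) ^ (-b) := by
  refine ((summable_one_div_nat_add_rpow (1 + x) b).2 hb).congr fun k => ?_
  have hpos := natCast_add_one_add_pos hx k
  rw [← add_assoc, abs_of_pos hpos, rpow_neg hpos.le, one_div]

theorem hasSum_shiftZeta {b x : ℝ} (hb : 1 < b) (hx : -1 < x) :
    HasSum (fun k : ℕ => ((k : ℝ) + 1 + x) ^ (-b)) (shiftZeta b x) :=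
  (summable_shiftZeta hb hx).hasSum

theorem hasDerivAt_shiftZeta {b x : ℝ} (hb : 1 < b) (hx : -1 < x) :
    HasDerivAt (shiftZeta b) (-b * shiftZeta (b + 1) x) x := by
  obtain ⟨c, hc, hcx⟩ := exists_between hx
  have hterm (k : ℕ) (y : ℝ) (hy : y ∈ Ioi c) : HasDerivAt (fun y => ((k : ℝ) + 1 + y) ^ (-b))
      (-b * ((k : ℝ) + 1 + y) ^ (-(b + 1))) y := by
    have hpos := natCast_add_one_add_pos (hc.trans hy) k
    refine (((hasDerivAt_id y).const_add ((k : ℝ) + 1)).rpow_const (Or.inl hpos.ne')).congr_deriv ?_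
    rw [one_mul, neg_add, sub_eq_add_neg, id]
  have hbound (k : ℕ) (y : ℝ) (hy : y ∈ Ioi c) :
      ‖-b * ((k : ℝ) + 1 + y) ^ (-(b + 1))‖ ≤ b * ((k : ℝ) + 1 + c) ^ (-(b + 1)) := by
    have hpos := natCast_add_one_add_pos hc k
    have hle : (k : ℝ) + 1 + c ≤ k + 1 + y := add_le_add_right (mem_Ioi.1 hy).le _
    rw [norm_mul, norm_of_nonneg (rpow_nonneg (hpos.le.trans hle) _), norm_neg,
      norm_of_nonneg (by linarith)]
    exact mul_le_mul_of_nonneg_left (rpow_le_rpow_of_nonpos hpos hle (by linarith)) (by linarith)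
  have hderiv := hasDerivAt_tsum_of_isPreconnected
    ((summable_shiftZeta (by linarith : 1 < b + 1) hc).mul_left b) isOpen_Ioi isPreconnected_Ioi
    hterm hbound hcx (summable_shiftZeta hb hx) hcx
  rwa [tsum_mul_left] at hderiv

theorem contDiffOn_shiftZeta (n : ℕ) {b : ℝ} (hb : 1 < b) :
    ContDiffOn ℝ n (shiftZeta b) (Ioi (-1)) := by
  induction n generalizing b with
  | zero =>
    exact contDiffOn_zero.2 fun x hx =>
      (hasDerivAt_shiftZeta hb hx).continuousAt.continuousWithinAt
  | succ n ih =>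
    push_cast
    rw [contDiffOn_succ_iff_deriv_of_isOpen isOpen_Ioi]
    refine ⟨fun x hx => (hasDerivAt_shiftZeta hb hx).differentiableAt.differentiableWithinAt,
      by simp, ?_⟩
    exact (contDiffOn_const.mul (ih (by linarith))).congr fun x hx =>
      (hasDerivAt_shiftZeta hb hx).deriv

theorem shiftZeta_nonneg (b : ℝ) {x : ℝ} (hx : -1 < x) : 0 ≤ shiftZeta b x :=
  tsum_nonneg fun k => rpow_nonneg (natCast_add_one_add_pos hx k).le _

/-- The part `∑_{k ≠ 0} |k + x|^{-b}` of `powKernel b` that is regular at `0`, for `|x| < 1`. -/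
noncomputable def regKernel (b x : ℝ) : ℝ := shiftZeta b x + shiftZeta b (-x)

theorem regKernel_neg (b x : ℝ) : regKernel b (-x) = regKernel b x := by
  rw [regKernel, regKernel, neg_neg, add_comm]

theorem regKernel_nonneg (b : ℝ) {x : ℝ} (hx : |x| < 1) : 0 ≤ regKernel b x :=
  add_nonneg (shiftZeta_nonneg b (abs_lt.1 hx).1)
    (shiftZeta_nonneg b (neg_lt_neg (abs_lt.1 hx).2))

theorem contDiffOn_regKernel (n : ℕ) {b : ℝ} (hb : 1 < b) :
    ContDiffOn ℝ n (regKernel b) (Ioo (-1) 1) := by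
  have hzeta := contDiffOn_shiftZeta n hb
  exact (hzeta.mono fun x hx => hx.1).add
    (hzeta.comp contDiff_neg.contDiffOn fun x hx => neg_lt_neg hx.2)

theorem Icc_half_subset_Ioo_one : Icc (-(1 / 2) : ℝ) (1 / 2) ⊆ Ioo (-1) 1 :=
  Icc_subset_Ioo (by norm_num) (by norm_num)

theorem continuousOn_regKernel {b : ℝ} (hb : 1 < b) :
    ContinuousOn (regKernel b) (Icc (-(1 / 2) : ℝ) (1 / 2)) :=
  (contDiffOn_regKernel 0 hb).continuousOn.mono Icc_half_subset_Ioo_one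

theorem powKernel_eq_add {b : ℝ} (hb : 1 < b) {x : ℝ} (hx : |x| < 1) :
    powKernel b x = |x| ^ (-b) + regKernel b x := by
  obtain ⟨hx_left, hx_right⟩ := abs_lt.1 hx
  have hx_neg : -1 < -x := neg_lt_neg hx_right
  have hpos (k : ℕ) : |((k + 1 : ℕ) : ℤ) + x| = (k : ℝ) + 1 + x := by
    push_cast
    exact abs_of_pos (natCast_add_one_add_pos hx_left k)
  have hneg (k : ℕ) : |((-((k : ℤ) + 1) : ℤ) : ℝ) + x| = (k : ℝ) + 1 + -x := by
    push_cast
    rw [abs_of_neg (by linarith [natCast_add_one_add_pos hx_neg k])]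
    ring
  have hsum_nonneg : HasSum (fun k : ℕ => |((k : ℤ) : ℝ) + x| ^ (-b))
      (|x| ^ (-b) + shiftZeta b x) := by
    rw [← hasSum_nat_add_iff' 1]
    simpa only [hpos, Finset.sum_range_one, Int.natCast_zero, Int.cast_zero, zero_add,
      add_sub_cancel_left] using hasSum_shiftZeta hb hx_left
  have hsum_neg : HasSum (fun k : ℕ => |((-((k : ℤ) + 1) : ℤ) : ℝ) + x| ^ (-b))
      (shiftZeta b (-x)) := by
    simpa only [hneg] using hasSum_shiftZeta hb hx_neg
  rw [powKernel, regKernel, ← add_assoc]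
  exact (HasSum.of_nat_of_neg_add_one (f := fun k : ℤ => |(k : ℝ) + x| ^ (-b)) hsum_nonneg
    hsum_neg).tsum_eq

theorem one_add_regKernel_pos (b : ℝ) {x : ℝ} (hx : |x| < 1) :
    0 < 1 + |x| ^ b * regKernel b x := by
  have := regKernel_nonneg b hx
  positivity

theorem powKernel_eq_mul {b : ℝ} (hb : 1 < b) {x : ℝ} (hx : |x| < 1) (hx0 : x ≠ 0) :
    powKernel b x = |x| ^ (-b) * (1 + |x| ^ b * regKernel b x) := by
  rw [powKernel_eq_add hb hx, mul_add, mul_one, ← mul_assoc, ← rpow_add (abs_pos.2 hx0),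
    neg_add_cancel, rpow_zero, one_mul]

theorem powKernel_pos {b : ℝ} (hb : 1 < b) {x : ℝ} (hx : |x| < 1) (hx0 : x ≠ 0) :
    0 < powKernel b x := by
  rw [powKernel_eq_mul hb hx hx0]
  have := one_add_regKernel_pos b hx
  have := abs_pos.2 hx0
  positivity

/-! ### The ratio of the spectral densities -/

theorem contDiff_sinc {n : WithTop ℕ∞} : ContDiff ℝ n sinc := by
  refine ContDiff.of_le (n := ⊤) (contDiff_iff_contDiffAt.2 fun x => ?_) le_top
  refine AnalyticAt.contDiffAt ?_
  rcases eq_or_ne x 0 with rfl | hx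
  · obtain ⟨p, hp⟩ := analyticAt_sin (x := 0)
    rw [sinc_eq_dslope]
    exact ⟨_, hp.has_fpower_series_dslope_fslope⟩
  · refine (analyticAt_sin.div analyticAt_id hx).congr ?_
    filter_upwards [isOpen_ne.mem_nhds hx] with y hy
    exact (sinc_of_ne_zero hy).symm

theorem sinc_pi_mul_abs (x : ℝ) : sinc (π * |x|) = sinc (π * x) := by
  rcases abs_choice x with h | h <;> rw [h]
  rw [mul_neg, sinc_neg]

theorem sinc_pi_mul_pos {x : ℝ} (hx : |x| < 1) : 0 < sinc (π * x) := by
  rcases eq_or_ne x 0 with rfl | hx0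
  · simp
  have hpos : 0 < π * |x| := mul_pos pi_pos (abs_pos.2 hx0)
  rw [← sinc_pi_mul_abs, sinc_of_ne_zero hpos.ne']
  exact div_pos (sin_pos_of_pos_of_lt_pi hpos (mul_lt_of_lt_one_right pi_pos hx)) hpos

/-- The factor `sinc(πx)^{-b}` of the spectral ratio, with `b = 2H + 1`. -/
noncomputable def sincWeight (b x : ℝ) : ℝ := sinc (π * x) ^ (-b)

theorem sincWeight_neg (b x : ℝ) : sincWeight b (-x) = sincWeight b x := by
  rw [sincWeight, sincWeight, mul_neg, sinc_neg]

theorem sincWeight_zero (b : ℝ) : sincWeight b 0 = 1 := by simp [sincWeight]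

theorem contDiffOn_sincWeight (b : ℝ) {n : WithTop ℕ∞} :
    ContDiffOn ℝ n (sincWeight b) (Ioo (-1) 1) :=
  (contDiff_sinc.comp (contDiff_const.mul contDiff_id)).contDiffOn.rpow_const_of_ne
    fun _ hx => (sinc_pi_mul_pos (abs_lt.2 hx)).ne'

theorem sincWeight_eq (b : ℝ) {x : ℝ} (hx : |x| < 1) (hx0 : x ≠ 0) :
    sincWeight b x = |sin (π * x)| ^ (-b) * (π ^ b * |x| ^ b) := by
  have hsinc : sinc (π * x) = |sin (π * x)| / (π * |x|) := by
    rw [← abs_of_pos (sinc_pi_mul_pos hx), sinc_of_ne_zero (mul_ne_zero pi_ne_zero hx0), abs_div,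
      abs_mul, abs_of_pos pi_pos]
  have hpos : 0 ≤ π * |x| := by positivity
  rw [sincWeight, hsinc, div_rpow (abs_nonneg _) hpos, rpow_neg hpos, div_inv_eq_mul,
    mul_rpow pi_pos.le (abs_nonneg x)]

theorem fgnSpectralDensity_eq (H c x : ℝ) : fgnSpectralDensity H c x
    = c * (π ^ 2)⁻¹ * sin (π * x) ^ 2 * powKernel (2 * H + 1) x := by
  have h2π : 0 < 2 * π := two_pi_pos
  have hterm (j : ℤ) : |2 * π * (j : ℝ) + 2 * π * x| ^ (-(2 * H + 1))
      = (2 * π) ^ (-(2 * H + 1)) * |(j : ℝ) + x| ^ (-(2 * H + 1)) := by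
    rw [← mul_add, abs_mul, abs_of_pos h2π, mul_rpow h2π.le (abs_nonneg _)]
  have := (rpow_pos_of_pos h2π (2 * H + 1)).ne'
  simp only [fgnSpectralDensity, powKernel, hterm]
  rw [tsum_mul_left, rpow_neg h2π.le]
  field_simp

section Ratio

variable {H : ℝ} {h : ℝ → ℝ}

theorem fracPrefactor_pos (h0 : 0 < h 0) : 0 < fracPrefactor H h :=
  mul_pos (rpow_pos_of_pos two_pi_pos _) h0

theorem spectralRatio_eq (hH : 0 < H) (h0 : h 0 ≠ 0) {x : ℝ} (hx : |x| ≤ 1 / 2) :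
    spectralRatio H h x = h x / h 0 * sincWeight (2 * H + 1) x
      * (1 + |x| ^ (2 * H + 1) * regKernel (2 * H + 1) x)⁻¹ := by
  rcases eq_or_ne x 0 with rfl | hx0
  · rw [spectralRatio, if_pos rfl, sincWeight_zero, abs_zero, zero_rpow (by linarith),
      div_self h0, zero_mul, add_zero, mul_one, inv_one, mul_one]
  have hx1 : |x| < 1 := by linarith
  have hxpos := abs_pos.2 hx0
  have hsin := abs_pos.2 (sin_pi_mul_ne_zero hx hx0)
  have hreg := (one_add_regKernel_pos (2 * H + 1) hx1).ne'
  have hfrac : fracSpectralDensity H h x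
      = h x * (2 ^ (1 - 2 * H) * (sin (π * x) ^ 2 * |sin (π * x)| ^ (-(2 * H + 1)))) := by
    rw [fracSpectralDensity, abs_mul, abs_two, mul_rpow two_pos.le hsin.le, ← sq_abs (sin _),
      ← rpow_two, ← rpow_add hsin]
    ring_nf
  have hpref : fracPrefactor H h = 2 ^ (1 - 2 * H) * (π ^ 2 * (π ^ (2 * H + 1))⁻¹) * h 0 := by
    rw [fracPrefactor, mul_rpow two_pos.le pi_pos.le, ← rpow_neg pi_pos.le, ← rpow_two,
      ← rpow_add pi_pos]
    ring_nf
  have h2pow := (rpow_pos_of_pos two_pos (1 - 2 * H)).ne'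
  have hπpow := (rpow_pos_of_pos pi_pos (2 * H + 1)).ne'
  have hxpow := (rpow_pos_of_pos hxpos (2 * H + 1)).ne'
  have hsin0 := sin_pi_mul_ne_zero hx hx0
  rw [spectralRatio, if_neg hx0, fgnSpectralDensity_eq, powKernel_eq_mul (by linarith) hx1 hx0,
    hfrac, hpref, sincWeight_eq _ hx1 hx0, rpow_neg hxpos.le]
  field_simp

theorem spectralRatio_neg (heven : ∀ x, h (-x) = h x) (hH : 0 < H) (h0 : h 0 ≠ 0) {x : ℝ}
    (hx : |x| ≤ 1 / 2) : spectralRatio H h (-x) = spectralRatio H h x := by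
  rw [spectralRatio_eq hH h0 hx, spectralRatio_eq hH h0 (by rwa [abs_neg]), heven,
    sincWeight_neg, regKernel_neg, abs_neg]

theorem continuousOn_spectralRatio (hH : 0 < H) (h0 : h 0 ≠ 0)
    (hcont : ContinuousOn h (Icc (-(1 / 2) : ℝ) (1 / 2))) :
    ContinuousOn (spectralRatio H h) (Icc (-(1 / 2) : ℝ) (1 / 2)) := by
  have hb : 1 < 2 * H + 1 := by linarith
  have hweight : ContinuousOn (sincWeight (2 * H + 1)) (Icc (-(1 / 2) : ℝ) (1 / 2)) :=
    (contDiffOn_sincWeight _ (n := 0)).continuousOn.mono Icc_half_subset_Ioo_one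
  have hpow : Continuous fun x : ℝ => |x| ^ (2 * H + 1) :=
    continuous_abs.rpow_const fun _ => Or.inr (by linarith)
  refine (((hcont.div_const _).mul hweight).mul ((continuousOn_const.add
    (hpow.continuousOn.mul (continuousOn_regKernel hb))).inv₀ fun x hx =>
      (one_add_regKernel_pos _ (abs_lt.2 (Icc_half_subset_Ioo_one hx))).ne')).congr
    fun x hx => spectralRatio_eq hH h0 (abs_le.2 hx)

theorem fracSpectralDensity_mul_div_sin_sq (hH : 0 < H) (h0 : 0 < h 0) {x : ℝ}
    (hx : |x| ≤ 1 / 2) (hx0 : x ≠ 0) (y : ℝ) :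
    fracSpectralDensity H h x * (y / sin (π * x) ^ 2) = fracPrefactor H h * (π ^ 2)⁻¹
      * (powKernel (2 * H + 1) x * spectralRatio H h x * y) := by
  have hsin := sin_pi_mul_ne_zero hx hx0
  have hkernel := (powKernel_pos (by linarith : 1 < 2 * H + 1) (by linarith) hx0).ne'
  have hpref := (fracPrefactor_pos (H := H) h0).ne'
  rw [spectralRatio, if_neg hx0, fgnSpectralDensity_eq]
  field_simp

end Ratio

/-! ### The ratio near the origin -/

theorem isBigO_sub_sq_of_even {φ : ℝ → ℝ} (heven : ∀ x, φ (-x) = φ x)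
    (hφ : ContDiffAt ℝ 2 φ 0) : (fun x => φ x - φ 0) =O[𝓝 0] fun x => x ^ 2 := by
  obtain ⟨u, hu, hφu⟩ := hφ.contDiffOn le_rfl (by simp)
  obtain ⟨ε, hε, hball⟩ := Metric.mem_nhds_iff.1 hu
  have htaylor := taylor_isLittleO (n := 2) (convex_ball (0 : ℝ) ε) (Metric.mem_ball_self hε)
    (hφu.mono hball)
  simp only [taylorWithinEval_succ, taylor_within_zero_eval, sub_zero,
    nhdsWithin_eq_nhds.2 (Metric.ball_mem_nhds (0 : ℝ) hε), smul_eq_mul] at htaylor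
  have hreflect := htaylor.comp_tendsto (continuous_neg.tendsto' (0 : ℝ) 0 neg_zero)
  simp only [Function.comp_def, heven, even_two.neg_pow] at hreflect
  -- averaging the Taylor expansions at `x` and `-x` removes the linear term
  have hquadratic : (fun x => φ x - φ 0 - iteratedDerivWithin 2 φ (Metric.ball 0 ε) 0 / 2 * x ^ 2)
      =o[𝓝 0] fun x => x ^ 2 := by
    refine ((htaylor.add hreflect).const_mul_left (1 / 2)).congr_left fun x => ?_
    norm_num
    ring
  simpa only [sub_add_cancel] using hquadratic.isBigO.add (isBigO_const_mul_self
    (iteratedDerivWithin 2 φ (Metric.ball 0 ε) 0 / 2) _ _)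

theorem exists_forall_abs_le_mul_sq {ψ : ℝ → ℝ} {r : ℝ} (hcont : ContinuousOn ψ (Icc (-r) r))
    (hψ : ψ =O[𝓝 0] fun x => x ^ 2) : ∃ C, ∀ x, |x| ≤ r → |ψ x| ≤ C * x ^ 2 := by
  obtain ⟨A, hnear⟩ := hψ.bound
  obtain ⟨ε, hε, hball⟩ := Metric.eventually_nhds_iff.1 hnear
  obtain ⟨B, hB⟩ := isCompact_Icc.exists_bound_of_continuousOn hcont
  refine ⟨max A (B / ε ^ 2), fun x hx => ?_⟩
  rcases lt_or_ge |x| ε with hxε | hxε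
  · have hxA := hball (y := x) (by simpa using hxε)
    rw [norm_eq_abs, norm_of_nonneg (sq_nonneg x)] at hxA
    exact hxA.trans (mul_le_mul_of_nonneg_right (le_max_left _ _) (sq_nonneg x))
  · have hxB : |ψ x| ≤ B := hB x (abs_le.1 hx)
    have hsq : ε ^ 2 ≤ x ^ 2 := sq_abs x ▸ pow_le_pow_left₀ hε.le hxε 2
    calc |ψ x| ≤ B / ε ^ 2 * ε ^ 2 := by rwa [div_mul_cancel₀ _ (by positivity)]
      _ ≤ B / ε ^ 2 * x ^ 2 := by
        have := (abs_nonneg _).trans hxB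
        gcongr
      _ ≤ max A (B / ε ^ 2) * x ^ 2 :=
        mul_le_mul_of_nonneg_right (le_max_right _ _) (sq_nonneg x)

theorem isBigO_abs_rpow_mul_regKernel {b : ℝ} (hb : 2 ≤ b) :
    (fun x => |x| ^ b * regKernel b x) =O[𝓝 0] fun x => x ^ 2 := by
  have hreg : regKernel b =O[𝓝 0] fun _ => (1 : ℝ) :=
    ((continuousOn_regKernel (by linarith)).continuousAt
      (Icc_mem_nhds (by norm_num) (by norm_num))).isBigO_one ℝ
  have hpow : (fun x : ℝ => |x| ^ b) =O[𝓝 0] fun x => x ^ 2 := by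
    refine IsBigO.of_bound 1 ?_
    filter_upwards [Metric.ball_mem_nhds (0 : ℝ) one_pos] with x hx
    have hx1 : |x| ≤ 1 := by simpa using (mem_ball_zero_iff.1 hx).le
    rw [one_mul, norm_of_nonneg (by positivity), norm_of_nonneg (sq_nonneg x), ← sq_abs,
      ← rpow_two]
    exact rpow_le_rpow_of_exponent_ge' (abs_nonneg x) hx1 two_pos.le hb
  simpa only [mul_one] using hpow.mul hreg

theorem isBigO_spectralRatio_sub_one {H : ℝ} (hH : 1 / 2 ≤ H) {h : ℝ → ℝ} (h0 : h 0 ≠ 0)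
    (hdiff : ContDiffAt ℝ 2 h 0) (heven : ∀ x, h (-x) = h x) :
    (fun x => spectralRatio H h x - 1) =O[𝓝 0] fun x => x ^ 2 := by
  set b := 2 * H + 1 with hbdef
  have hnhds : Icc (-(1 / 2) : ℝ) (1 / 2) ∈ 𝓝 0 := Icc_mem_nhds (by norm_num) (by norm_num)
  have hsmooth : (fun x => h x / h 0 * sincWeight b x - 1) =O[𝓝 0] fun x => x ^ 2 := by
    have hweight := (contDiffOn_sincWeight b (n := 2)).contDiffAt
      (Ioo_mem_nhds (by norm_num) one_pos : Ioo (-1) 1 ∈ 𝓝 (0 : ℝ))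
    simpa only [div_self h0, sincWeight_zero, mul_one] using isBigO_sub_sq_of_even
      (fun x => by rw [heven, sincWeight_neg]) ((hdiff.div_const (h 0)).mul hweight)
  have hsum := hsmooth.sub (isBigO_abs_rpow_mul_regKernel (b := b) (by linarith))
  refine IsBigO.trans (IsBigO.of_bound 1 ?_) hsum
  filter_upwards [hnhds] with x hx
  have hx2 := abs_le.2 hx
  have hden := one_add_regKernel_pos b (show |x| < 1 by linarith)
  have hreg := regKernel_nonneg b (show |x| < 1 by linarith)
  rw [spectralRatio_eq (by linarith) h0 hx2, ← hbdef, ← div_eq_mul_inv, div_sub_one hden.ne',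
    norm_div, one_mul, ← sub_sub, norm_of_nonneg hden.le]
  exact div_le_self (norm_nonneg _) (le_add_of_nonneg_right (by positivity))

theorem exists_abs_spectralRatio_sub_one_le {H : ℝ} (hH : 1 / 2 ≤ H) {h : ℝ → ℝ} (h0 : h 0 ≠ 0)
    (hcont : ContinuousOn h (Icc (-(1 / 2) : ℝ) (1 / 2))) (hdiff : ContDiffAt ℝ 2 h 0)
    (heven : ∀ x, h (-x) = h x) :
    ∃ C, ∀ x, |x| ≤ 1 / 2 → |spectralRatio H h x - 1| ≤ C * x ^ 2 :=
  exists_forall_abs_le_mul_sq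
    ((continuousOn_spectralRatio (by linarith) h0 hcont).sub continuousOn_const)
    (isBigO_spectralRatio_sub_one hH h0 hdiff heven)

/-! ### Integrability -/

theorem intervalIntegrable_abs_rpow {r : ℝ} (hr : -1 < r) (a b : ℝ) :
    IntervalIntegrable (fun x : ℝ => |x| ^ r) volume a b := by
  have hpos {c : ℝ} (hc : 0 ≤ c) : IntervalIntegrable (fun x : ℝ => |x| ^ r) volume 0 c :=
    (intervalIntegral.intervalIntegrable_rpow' hr).congr fun x hx => by
      simp only [abs_of_pos (uIoc_of_le hc ▸ hx).1]
  have hzero (c : ℝ) : IntervalIntegrable (fun x : ℝ => |x| ^ r) volume 0 c := by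
    rcases le_total 0 c with hc | hc
    · exact hpos hc
    · rw [IntervalIntegrable.iff_comp_neg]
      simpa only [abs_neg, neg_zero] using hpos (neg_nonneg.2 hc)
  exact (hzero a).symm.trans (hzero b)

theorem intervalIntegrable_abs_two_sin_rpow {r : ℝ} (hr : -1 < r) (hr0 : r ≤ 0) :
    IntervalIntegrable (fun x : ℝ => |2 * sin (π * x)| ^ r) volume (-(1 / 2)) (1 / 2) := by
  refine ((intervalIntegrable_abs_rpow hr _ _).const_mul (4 ^ r)).mono_fun'
    (Measurable.aestronglyMeasurable (by fun_prop)) ?_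
  filter_upwards [ae_restrict_mem measurableSet_uIoc,
    ae_restrict_of_ae (Measure.ae_ne volume 0)] with x hx hx0
  have := abs_pos.2 hx0
  rw [norm_of_nonneg (by positivity), ← mul_rpow four_pos.le (abs_nonneg x)]
  exact rpow_le_rpow_of_nonpos (by positivity)
    (four_mul_abs_le_abs_two_mul_sin (abs_le.2 (mem_Icc_of_mem_uIoc_half hx))) hr0

theorem intervalIntegrable_fracSpectralDensity {H : ℝ} (hH : 1 / 2 ≤ H) (hH1 : H < 1)
    {h : ℝ → ℝ} (hcont : ContinuousOn h (Icc (-(1 / 2) : ℝ) (1 / 2))) :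
    IntervalIntegrable (fracSpectralDensity H h) volume (-(1 / 2)) (1 / 2) :=
  ((intervalIntegrable_abs_two_sin_rpow (by linarith : -1 < -(2 * H - 1)) (by linarith))
    |>.mul_continuousOn (uIcc_half ▸ hcont)).congr fun _ _ => mul_comm _ _

theorem exists_powKernel_le_mul_rpow {b : ℝ} (hb : 1 < b) :
    ∃ B, 0 ≤ B ∧ ∀ x, |x| ≤ 1 / 2 → x ≠ 0 → powKernel b x ≤ B * |x| ^ (-b) := by
  obtain ⟨B, hB⟩ := isCompact_Icc.exists_bound_of_continuousOn (continuousOn_regKernel hb)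
  have hB0 : 0 ≤ B := (norm_nonneg _).trans (hB 0 (by norm_num))
  refine ⟨1 + B, by positivity, fun x hx hx0 => ?_⟩
  have hpow : |x| ^ b ≤ 1 := rpow_le_one (abs_nonneg x) (by linarith) (by linarith)
  have hreg : regKernel b x ≤ B := (le_abs_self _).trans (hB x (abs_le.1 hx))
  rw [powKernel_eq_mul hb (by linarith) hx0, mul_comm]
  gcongr
  exact (mul_le_of_le_one_left (regKernel_nonneg b (by linarith)) hpow).trans hreg

theorem aestronglyMeasurable_powKernel {b : ℝ} (hb : 1 < b) :
    AEStronglyMeasurable (powKernel b) (volume.restrict (uIoc (-(1 / 2)) (1 / 2))) := by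
  have hsum : AEStronglyMeasurable (fun x => |x| ^ (-b) + regKernel b x)
      (volume.restrict (uIoc (-(1 / 2)) (1 / 2))) :=
    AEStronglyMeasurable.add (Measurable.aestronglyMeasurable (by fun_prop))
      (((continuousOn_regKernel hb).mono fun _ => mem_Icc_of_mem_uIoc_half).aestronglyMeasurable
        measurableSet_uIoc)
  refine hsum.congr ?_
  filter_upwards [ae_restrict_mem measurableSet_uIoc] with x hx
  have hx2 : |x| ≤ 1 / 2 := abs_le.2 (mem_Icc_of_mem_uIoc_half hx)
  rw [powKernel_eq_add hb (by linarith)]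

theorem intervalIntegrable_powKernel_mul {b : ℝ} (hb : 1 < b) (hb3 : b < 3) {ψ : ℝ → ℝ}
    (hcont : ContinuousOn ψ (Icc (-(1 / 2) : ℝ) (1 / 2))) {C : ℝ}
    (hψ : ∀ x, |x| ≤ 1 / 2 → |ψ x| ≤ C * x ^ 2) :
    IntervalIntegrable (fun x => powKernel b x * ψ x) volume (-(1 / 2)) (1 / 2) := by
  obtain ⟨B, hB0, hB⟩ := exists_powKernel_le_mul_rpow hb
  refine ((intervalIntegrable_abs_rpow (by linarith : -1 < 2 - b) _ _).const_mul
    (B * C)).mono_fun' ((aestronglyMeasurable_powKernel hb).mul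
      ((hcont.mono fun _ => mem_Icc_of_mem_uIoc_half).aestronglyMeasurable measurableSet_uIoc)) ?_
  filter_upwards [ae_restrict_mem measurableSet_uIoc,
    ae_restrict_of_ae (Measure.ae_ne volume 0)] with x hx hx0
  have hx2 : |x| ≤ 1 / 2 := abs_le.2 (mem_Icc_of_mem_uIoc_half hx)
  rw [norm_mul, norm_of_nonneg (powKernel_pos hb (by linarith) hx0).le]
  calc powKernel b x * ‖ψ x‖ ≤ B * |x| ^ (-b) * (C * x ^ 2) := by
        gcongr
        exacts [hB x hx2 hx0, hψ x hx2]
    _ = B * C * |x| ^ (2 - b) := by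
        rw [sub_eq_neg_add, rpow_add (abs_pos.2 hx0), rpow_two, sq_abs]
        ring

/-! ### The additive constant -/

/-- The cosine coefficient of `g` at the frequency `t`; `ratioCoeff H h j` is the coefficient of
`spectralRatio H h` at the integer `j`. -/
noncomputable def cosCoeff (g : ℝ → ℝ) (t : ℝ) : ℝ :=
  ∫ x in (-(1 / 2) : ℝ)..(1 / 2), g x * cos (2 * π * t * x)

theorem tendsto_cosCoeff_cocompact {g : ℝ → ℝ}
    (hg : IntervalIntegrable g volume (-(1 / 2)) (1 / 2)) :
    Tendsto (cosCoeff g) (cocompact ℝ) (𝓝 0) := by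
  have hint : Integrable ((Ioc (-(1 / 2)) (1 / 2)).indicator g) :=
    IntegrableOn.integrable_indicator
      ((intervalIntegrable_iff_integrableOn_Ioc_of_le (by norm_num)).1 hg) measurableSet_Ioc
  set G : ℝ → ℝ := (Ioc (-(1 / 2)) (1 / 2)).indicator g with hG
  have hlim := (Complex.continuous_re.tendsto 0).comp
    (Real.tendsto_integral_exp_smul_cocompact fun x => (G x : ℂ))
  rw [Complex.zero_re] at hlim
  refine hlim.congr fun t => ?_
  have hintegrable : Integrable fun x => Real.fourierChar (-(x * t)) • (G x : ℂ) :=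
    (VectorFourier.fourierIntegral_convergent_iff Real.continuous_fourierChar
      (by fun_prop : Continuous fun p : ℝ × ℝ => LinearMap.mul ℝ ℝ p.1 p.2) t).2 hint.ofReal
  have hre := Complex.reCLM.integral_comp_comm hintegrable
  simp only [Complex.reCLM_apply] at hre
  rw [Function.comp_apply, ← hre, cosCoeff, intervalIntegral.integral_of_le (by norm_num),
    ← integral_indicator measurableSet_Ioc]
  congr 1 with x
  have hterm : (Real.fourierChar (-(x * t)) • (G x : ℂ)).re = G x * cos (2 * π * t * x) := by
    rw [Circle.smul_def, Real.fourierChar_apply, smul_eq_mul, Complex.re_mul_ofReal,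
      Complex.exp_ofReal_mul_I_re, mul_comm, mul_neg, cos_neg, mul_comm x, ← mul_assoc]
  rw [hterm, hG, indicator_mul_left]

theorem tendsto_integral_mul_sin_sq {g : ℝ → ℝ}
    (hg : IntervalIntegrable g volume (-(1 / 2)) (1 / 2)) :
    Tendsto (fun n : ℕ => ∫ x in (-(1 / 2) : ℝ)..(1 / 2), g x * sin (π * n * x) ^ 2) atTop
      (𝓝 ((∫ x in (-(1 / 2) : ℝ)..(1 / 2), g x) / 2)) := by
  have hcos := (tendsto_cosCoeff_cocompact hg).comp
    (tendsto_natCast_atTop_atTop.mono_right atTop_le_cocompact)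
  have hlim := (hcos.const_sub (∫ x in (-(1 / 2) : ℝ)..(1 / 2), g x)).div_const 2
  rw [sub_zero] at hlim
  refine hlim.congr fun n => ?_
  rw [Function.comp_apply, cosCoeff, ← intervalIntegral.integral_sub hg
    (hg.mul_continuousOn (by fun_prop)), ← intervalIntegral.integral_div]
  refine intervalIntegral.integral_congr fun x _ => ?_
  rw [sin_sq_eq_half_sub]
  ring_nf

/-- The additive constant attached to a ratio `g` of spectral densities: the integral of `g - 1`
against the periodised kernel, normalised by `2 * sineIntegral (2 * H)` so that it is relative to
the variance of the fractional Gaussian noise. -/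
noncomputable def additiveConst (H : ℝ) (g : ℝ → ℝ) : ℝ :=
  (∫ x in (-(1 / 2) : ℝ)..(1 / 2), powKernel (2 * H + 1) x * (g x - 1)) / (2 * sineIntegral (2 * H))

section Fejer

variable {H : ℝ} {h : ℝ → ℝ}

theorem integral_powKernel_mul_sin_sq_natCast (hH : 0 < H) (hH1 : H < 1) (n : ℕ) :
    ∫ x in (-(1 / 2) : ℝ)..(1 / 2), powKernel (2 * H + 1) x * sin (π * n * x) ^ 2
      = sineIntegral (2 * H) * (n : ℝ) ^ (2 * H) := by
  rcases Nat.eq_zero_or_pos n with rfl | hn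
  · simp [zero_rpow (by linarith : 2 * H ≠ 0)]
  · exact integral_powKernel_mul_sin_sq (by linarith) (by linarith) hn

theorem fejerIntegral_fracSpectralDensity_sub (hH : 0 < H) (hH1 : H < 1) (h0 : 0 < h 0)
    (hint : IntervalIntegrable (fun x => powKernel (2 * H + 1) x * (spectralRatio H h x - 1))
      volume (-(1 / 2)) (1 / 2)) (n : ℕ) :
    fejerIntegral (fracSpectralDensity H h) n - fgnVTF H (fgnVariance H (fracPrefactor H h)) n
      = fracPrefactor H h * (π ^ 2)⁻¹ * ∫ x in (-(1 / 2) : ℝ)..(1 / 2),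
          powKernel (2 * H + 1) x * (spectralRatio H h x - 1) * sin (π * n * x) ^ 2 := by
  set κ := fracPrefactor H h * (π ^ 2)⁻¹
  have hfejer : fejerIntegral (fracSpectralDensity H h) n
      = κ * ∫ x in (-(1 / 2) : ℝ)..(1 / 2), (powKernel (2 * H + 1) x * sin (π * n * x) ^ 2
        + powKernel (2 * H + 1) x * (spectralRatio H h x - 1) * sin (π * n * x) ^ 2) := by
    rw [fejerIntegral, ← intervalIntegral.integral_const_mul]
    refine intervalIntegral.integral_congr_ae ?_
    filter_upwards [Measure.ae_ne volume 0] with x hx0 hx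
    rw [fracSpectralDensity_mul_div_sin_sq hH h0 (abs_le.2 (mem_Icc_of_mem_uIoc_half hx)) hx0]
    ring
  rw [hfejer, intervalIntegral.integral_add
    (intervalIntegrable_powKernel_mul_sin_sq (by linarith) (by linarith) n)
    (hint.mul_continuousOn (by fun_prop)), integral_powKernel_mul_sin_sq_natCast hH hH1, fgnVTF,
    fgnVariance_eq hH hH1]
  ring

theorem tendsto_fejerIntegral_sub_fgnVTF (hH : 0 < H) (hH1 : H < 1) (h0 : 0 < h 0)
    (hint : IntervalIntegrable (fun x => powKernel (2 * H + 1) x * (spectralRatio H h x - 1))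
      volume (-(1 / 2)) (1 / 2)) :
    Tendsto (fun n : ℕ => fejerIntegral (fracSpectralDensity H h) n
        - fgnVTF H (fgnVariance H (fracPrefactor H h)) n) atTop
      (𝓝 (fgnVariance H (fracPrefactor H h) * additiveConst H (spectralRatio H h))) := by
  have hlim := (tendsto_integral_mul_sin_sq hint).const_mul (fracPrefactor H h * (π ^ 2)⁻¹)
  simp only [fejerIntegral_fracSpectralDensity_sub hH hH1 h0 hint]
  convert hlim using 2
  have := (sineIntegral_pos (by linarith : 0 < 2 * H) (by linarith)).ne'
  rw [fgnVariance_eq hH hH1, additiveConst]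
  field_simp

end Fejer

/-! ### Correlation time functions under aggregation -/

section Aggregation

variable {ω : ℕ → ℝ} {V D s : ℝ}

theorem tendsto_div_rpow_of_tendsto_sub (hs : 0 < s)
    (hω : Tendsto (fun n : ℕ => ω n - V * (n : ℝ) ^ s) atTop (𝓝 (V * D))) :
    Tendsto (fun n : ℕ => ω n / (n : ℝ) ^ s) atTop (𝓝 V) := by
  have hpow : Tendsto (fun n : ℕ => (n : ℝ) ^ s) atTop atTop :=
    (tendsto_rpow_atTop hs).comp tendsto_natCast_atTop_atTop
  have hlim := (hω.div_atTop hpow).add_const V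
  rw [zero_add] at hlim
  refine hlim.congr' ?_
  filter_upwards [eventually_gt_atTop 0] with n hn
  have := (rpow_pos_of_pos (Nat.cast_pos.2 hn : (0 : ℝ) < n) s).ne'
  field_simp
  ring

theorem isLittleO_div_sub_rpow (hV : 0 < V) (hs : 0 < s)
    (hω : Tendsto (fun n : ℕ => ω n - V * (n : ℝ) ^ s) atTop (𝓝 (V * D))) {n : ℕ} (hn : 1 ≤ n) :
    (fun m : ℕ => ω (n * m) / ω m - ((n : ℝ) ^ s + D * (1 - (n : ℝ) ^ s) * (m : ℝ) ^ (-s)))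
      =o[atTop] fun m : ℕ => (m : ℝ) ^ (-s) := by
  have hratio := tendsto_div_rpow_of_tendsto_sub hs hω
  have hdilated : Tendsto (fun m : ℕ => ω (n * m) - V * ((n * m : ℕ) : ℝ) ^ s) atTop
      (𝓝 (V * D)) := hω.comp (tendsto_id.const_mul_atTop' hn)
  have hlim := ((hdilated.sub (hω.const_mul ((n : ℝ) ^ s))).sub
    (hratio.const_mul (D * (1 - (n : ℝ) ^ s)))).div hratio hV.ne'
  rw [show V * D - (n : ℝ) ^ s * (V * D) - D * (1 - (n : ℝ) ^ s) * V = 0 by ring,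
    zero_div] at hlim
  rw [isLittleO_iff_tendsto']
  · refine hlim.congr' ?_
    filter_upwards [eventually_gt_atTop 0, hratio.eventually_ne hV.ne'] with m hm hne
    have hm0 : (0 : ℝ) < m := Nat.cast_pos.2 hm
    have hpow := (rpow_pos_of_pos hm0 s).ne'
    have hωm : ω m ≠ 0 := left_ne_zero_of_mul (div_eq_mul_inv (ω m) _ ▸ hne)
    rw [Pi.div_apply, Nat.cast_mul, mul_rpow n.cast_nonneg hm0.le, rpow_neg hm0.le]
    field_simp
    ring
  · filter_upwards [eventually_gt_atTop 0] with m hm hzero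
    exact absurd hzero (rpow_pos_of_pos (Nat.cast_pos.2 hm) _).ne'

end Aggregation

/-! ### The additive constant as a cosine series -/

theorem integral_eq_zero_of_odd {E : Type*} [NormedAddCommGroup E] [NormedSpace ℝ E] {f : ℝ → E}
    {a : ℝ} (hodd : ∀ x ∈ uIcc (-a) a, f (-x) = -f x) : ∫ x in (-a)..a, f x = 0 := by
  have hneg := intervalIntegral.integral_comp_neg (a := -a) (b := a) f
  rw [neg_neg, intervalIntegral.integral_congr hodd, intervalIntegral.integral_neg] at hneg
  have htwo : (2 : ℝ) • ∫ x in (-a)..a, f x = 0 := by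
    rw [two_smul]
    nth_rw 1 [← hneg]
    exact neg_add_cancel _
  exact (smul_eq_zero_iff_right two_ne_zero).1 htwo

section CosineSeries

variable {g : ℝ → ℝ}

theorem cosCoeff_neg (g : ℝ → ℝ) (t : ℝ) : cosCoeff g (-t) = cosCoeff g t := by
  simp only [cosCoeff, mul_neg, neg_mul, cos_neg]

theorem fourierCoeff_liftIco_of_even (heven : ∀ x, |x| ≤ 1 / 2 → g (-x) = g x)
    (hg : IntervalIntegrable g volume (-(1 / 2)) (1 / 2)) (n : ℤ) :
    fourierCoeff (AddCircle.liftIco (1 : ℝ) (-(1 / 2)) fun x => (g x : ℂ)) n = cosCoeff g n := by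
  have hsin : ∫ x in (-(1 / 2) : ℝ)..(1 / 2), g x * sin (2 * π * n * x) = 0 :=
    integral_eq_zero_of_odd fun x hx => by
      rw [heven x (abs_le.2 (uIcc_half.subset hx)), mul_neg, sin_neg, mul_neg]
  have hsplit (x : ℝ) : fourier (-n) (x : AddCircle (1 : ℝ)) • (g x : ℂ)
      = ((g x * cos (2 * π * n * x) : ℝ) : ℂ) - ((g x * sin (2 * π * n * x) : ℝ) : ℂ)
        * Complex.I := by
    have harg : 2 * (π : ℂ) * Complex.I * (-n : ℤ) * x / (1 : ℝ)
        = ((-(2 * π * n * x) : ℝ) : ℂ) * Complex.I := by push_cast; ring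
    rw [fourier_coe_apply, smul_eq_mul, harg, Complex.exp_mul_I, ← Complex.ofReal_cos,
      ← Complex.ofReal_sin, cos_neg, sin_neg]
    push_cast
    ring
  have hintegrable {w : ℝ → ℝ} (hw : Continuous w) :
      IntervalIntegrable (fun x => ((g x * w x : ℝ) : ℂ)) volume (-(1 / 2)) (1 / 2) :=
    have hgw := hg.mul_continuousOn hw.continuousOn
    ⟨hgw.1.ofReal, hgw.2.ofReal⟩
  rw [fourierCoeff_liftIco_eq, fourierCoeffOn_eq_integral]
  rw [show (-(1 / 2) : ℝ) + 1 = 1 / 2 by norm_num, show (1 / 2 : ℝ) - -(1 / 2) = 1 by norm_num,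
    one_div_one, one_smul]
  simp only [hsplit]
  rw [intervalIntegral.integral_sub (hintegrable (by fun_prop))
      ((hintegrable (by fun_prop)).mul_const _),
    intervalIntegral.integral_mul_const, intervalIntegral.integral_ofReal,
    intervalIntegral.integral_ofReal, hsin, Complex.ofReal_zero, zero_mul, sub_zero, cosCoeff]

theorem hasSum_cosCoeff_mul_cos (heven : ∀ x, |x| ≤ 1 / 2 → g (-x) = g x)
    (hcont : ContinuousOn g (Icc (-(1 / 2) : ℝ) (1 / 2)))
    (hsum : Summable fun n : ℤ => cosCoeff g n) {x : ℝ} (hx : x ∈ Ico (-(1 / 2) : ℝ) (1 / 2)) :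
    HasSum (fun n : ℤ => cosCoeff g n * cos (2 * π * n * x)) (g x) := by
  have hlen : (-(1 / 2) : ℝ) + 1 = 1 / 2 := by norm_num
  set G := AddCircle.liftIco (1 : ℝ) (-(1 / 2)) fun x => (g x : ℂ) with hG
  have hGcont : Continuous G := AddCircle.liftIco_continuous
    (by rw [hlen, heven (1 / 2) (by norm_num)])
    (Complex.continuous_ofReal.comp_continuousOn (by rwa [hlen]))
  have hcoeff (n : ℤ) : fourierCoeff G n = cosCoeff g n :=
    fourierCoeff_liftIco_of_even heven (uIcc_half ▸ hcont).intervalIntegrable n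
  have hseries := has_pointwise_sum_fourier_series_of_summable (f := ⟨G, hGcont⟩)
    ((Complex.summable_ofReal.2 hsum).congr fun n => (hcoeff n).symm) (x : AddCircle (1 : ℝ))
  have hre := Complex.hasSum_re hseries
  rw [ContinuousMap.coe_mk, hG, AddCircle.liftIco_coe_apply (by rwa [hlen]),
    Complex.ofReal_re] at hre
  refine hre.congr_fun fun n => ?_
  have harg : 2 * (π : ℂ) * Complex.I * n * x / (1 : ℝ)
      = ((2 * π * n * x : ℝ) : ℂ) * Complex.I := by push_cast; ring
  rw [ContinuousMap.coe_mk, ← hG, hcoeff, ContinuousMap.toFun_eq_coe, fourier_coe_apply,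
    smul_eq_mul, Complex.re_ofReal_mul, harg, Complex.exp_ofReal_mul_I_re]

theorem hasSum_cosCoeff_mul_sin_sq (heven : ∀ x, |x| ≤ 1 / 2 → g (-x) = g x)
    (hcont : ContinuousOn g (Icc (-(1 / 2) : ℝ) (1 / 2)))
    (hsum : Summable fun j : ℕ => |cosCoeff g j|) {x : ℝ}
    (hx : x ∈ Ico (-(1 / 2) : ℝ) (1 / 2)) :
    HasSum (fun j : ℕ => -4 * cosCoeff g j * sin (π * j * x) ^ 2) (g x - g 0) := by
  have hsum_int : Summable fun n : ℤ => cosCoeff g n :=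
    Summable.of_nat_of_neg (by simpa using hsum.of_abs)
      (by simpa [cosCoeff_neg] using hsum.of_abs)
  have hdiff := (hasSum_cosCoeff_mul_cos heven hcont hsum_int hx).sub
    (hasSum_cosCoeff_mul_cos heven hcont hsum_int (x := 0) (by norm_num))
  have hfold := hdiff.nat_add_neg
  simp only [Int.cast_zero, mul_zero, zero_mul, cos_zero, sub_self, add_zero] at hfold
  refine hfold.congr_fun fun j => ?_
  simp only [Int.cast_neg, Int.cast_natCast, cosCoeff_neg, mul_neg, neg_mul, cos_neg]
  rw [sin_sq_eq_half_sub]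
  ring_nf

theorem summable_abs_cosCoeff_of_summable {s : ℝ} (hs : 0 ≤ s)
    (hsum : Summable fun j : ℕ => (j : ℝ) ^ s * |cosCoeff g j|) :
    Summable fun j : ℕ => |cosCoeff g j| := by
  refine hsum.of_norm_bounded_eventually_nat ?_
  filter_upwards [eventually_ge_atTop 1] with j hj
  rw [norm_eq_abs, abs_abs]
  exact le_mul_of_one_le_left (abs_nonneg _) (one_le_rpow (Nat.one_le_cast.2 hj) hs)

theorem hasSum_integral_powKernel_mul_sin_sq {H : ℝ} (hH : 0 < H) (hH1 : H < 1) {c : ℕ → ℝ}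
    (hsum : Summable fun j : ℕ => (j : ℝ) ^ (2 * H) * |c j|) :
    HasSum (fun j : ℕ => c j * (sineIntegral (2 * H) * (j : ℝ) ^ (2 * H)))
      (∫ x in (-(1 / 2) : ℝ)..(1 / 2),
        ∑' j : ℕ, c j * (powKernel (2 * H + 1) x * sin (π * j * x) ^ 2)) := by
  have hle : (-(1 / 2) : ℝ) ≤ 1 / 2 := by norm_num
  have hkernel (x : ℝ) : 0 ≤ powKernel (2 * H + 1) x := tsum_nonneg fun k => by positivity
  have hint (a : ℝ) (j : ℕ) : ∫ x in Ioc (-(1 / 2) : ℝ) (1 / 2),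
      a * (powKernel (2 * H + 1) x * sin (π * j * x) ^ 2)
        = a * (sineIntegral (2 * H) * (j : ℝ) ^ (2 * H)) := by
    rw [← intervalIntegral.integral_of_le hle, intervalIntegral.integral_const_mul,
      integral_powKernel_mul_sin_sq_natCast hH hH1]
  have hnorm (j : ℕ) : ∫ x in Ioc (-(1 / 2) : ℝ) (1 / 2),
      ‖c j * (powKernel (2 * H + 1) x * sin (π * j * x) ^ 2)‖
        = sineIntegral (2 * H) * ((j : ℝ) ^ (2 * H) * |c j|) := by
    simp only [norm_mul, norm_pow, norm_of_nonneg (hkernel _), norm_eq_abs, sq_abs, hint]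
    ring
  have hswap := hasSum_integral_of_summable_integral_norm
    (fun j => (intervalIntegrable_iff_integrableOn_Ioc_of_le hle).1
      ((intervalIntegrable_powKernel_mul_sin_sq (by linarith) (by linarith) j).const_mul (c j)))
    ((hsum.mul_left _).congr fun j => (hnorm j).symm)
  rw [intervalIntegral.integral_of_le hle]
  simpa only [hint] using hswap

theorem additiveConst_eq_tsum {H : ℝ} (hH : 0 < H) (hH1 : H < 1)
    (heven : ∀ x, |x| ≤ 1 / 2 → g (-x) = g x) (hg0 : g 0 = 1)
    (hcont : ContinuousOn g (Icc (-(1 / 2) : ℝ) (1 / 2)))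
    (hsum : Summable fun j : ℕ => (j : ℝ) ^ (2 * H) * |cosCoeff g j|) :
    additiveConst H g = -2 * ∑' j : ℕ, (j : ℝ) ^ (2 * H) * cosCoeff g j := by
  have hpointwise : ∀ᵐ x : ℝ, x ∈ uIoc (-(1 / 2)) (1 / 2) → powKernel (2 * H + 1) x * (g x - 1)
      = ∑' j : ℕ, -4 * cosCoeff g j * (powKernel (2 * H + 1) x * sin (π * j * x) ^ 2) := by
    filter_upwards [Measure.ae_ne volume (1 / 2)] with x hx_ne hx
    have hxIcc := mem_Icc_of_mem_uIoc_half hx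
    have hseries := hasSum_cosCoeff_mul_sin_sq heven hcont
      (summable_abs_cosCoeff_of_summable (by linarith) hsum) ⟨hxIcc.1, hxIcc.2.lt_of_ne hx_ne⟩
    rw [hg0] at hseries
    rw [← (hseries.mul_left (powKernel (2 * H + 1) x)).tsum_eq]
    exact tsum_congr fun j => by ring
  have hsum4 : Summable fun j : ℕ => (j : ℝ) ^ (2 * H) * |-4 * cosCoeff g j| :=
    (hsum.mul_left 4).congr fun j => by rw [abs_mul, abs_neg, Nat.abs_ofNat, mul_left_comm]
  have hpos := sineIntegral_pos (by linarith : 0 < 2 * H) (by linarith)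
  rw [additiveConst, intervalIntegral.integral_congr_ae hpointwise,
    ← (hasSum_integral_powKernel_mul_sin_sq hH hH1 hsum4).tsum_eq, ← tsum_div_const,
    ← tsum_mul_left]
  refine tsum_congr fun j => ?_
  field_simp
  ring

end CosineSeries

/-! ### Decay of the Fourier coefficients -/

/-- The `n`-th derivative of `f` is integrable over `[-1/2, 1/2]`: away from `0`, `f` is `n` times
differentiable on `(-1, 1)`, and its derivatives of order less than `n` extend continuously across
`0`. The interval exceeds a period on both sides so that the derivatives of a periodic function
agree at `±1/2`. -/
def HasIntegrableDeriv : ℕ → (ℝ → ℝ) → Prop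
  | 0, f => IntervalIntegrable f volume (-(1 / 2)) (1 / 2)
  | n + 1, f => ContinuousOn f (Ioo (-1) 1) ∧ ∃ f' : ℝ → ℝ,
      (∀ x ∈ Ioo (-1 : ℝ) 1, x ≠ 0 → HasDerivAt f (f' x) x) ∧ HasIntegrableDeriv n f'

namespace HasIntegrableDeriv

variable {n : ℕ} {f g : ℝ → ℝ}

theorem continuousOn_uIcc (hf : HasIntegrableDeriv (n + 1) f) :
    ContinuousOn f (uIcc (-(1 / 2)) (1 / 2)) :=
  hf.1.mono (uIcc_half.trans_subset Icc_half_subset_Ioo_one)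

theorem of_succ (hf : HasIntegrableDeriv (n + 1) f) : HasIntegrableDeriv n f := by
  induction n generalizing f with
  | zero => exact hf.continuousOn_uIcc.intervalIntegrable
  | succ n ih =>
    obtain ⟨hcont, f', hderiv, hf'⟩ := hf
    exact ⟨hcont, f', hderiv, ih hf'⟩

theorem intervalIntegrable (hf : HasIntegrableDeriv n f) :
    IntervalIntegrable f volume (-(1 / 2)) (1 / 2) := by
  induction n with
  | zero => exact hf
  | succ n ih => exact ih hf.of_succ

theorem add (hf : HasIntegrableDeriv n f) (hg : HasIntegrableDeriv n g) :
    HasIntegrableDeriv n (fun x => f x + g x) := by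
  induction n generalizing f g with
  | zero => exact IntervalIntegrable.add hf hg
  | succ n ih =>
    obtain ⟨hfcont, f', hfderiv, hf'⟩ := hf
    obtain ⟨hgcont, g', hgderiv, hg'⟩ := hg
    exact ⟨hfcont.add hgcont, _, fun x hx hx0 => (hfderiv x hx hx0).add (hgderiv x hx hx0),
      ih hf' hg'⟩

theorem mul_of_succ (hf : HasIntegrableDeriv n f) (hg : HasIntegrableDeriv (n + 1) g) :
    HasIntegrableDeriv n (fun x => f x * g x) := by
  induction n generalizing f g with
  | zero => exact IntervalIntegrable.mul_continuousOn hf hg.continuousOn_uIcc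
  | succ n ih =>
    have hg_pred := hg.of_succ
    obtain ⟨hgcont, g', hgderiv, hg'⟩ := hg
    have hfg' := ih hg'.of_succ hf
    obtain ⟨hfcont, f', hfderiv, hf'⟩ := hf
    refine ⟨hfcont.mul hgcont, fun x => f' x * g x + g' x * f x,
      fun x hx hx0 => ?_, (ih hf' hg_pred).add hfg'⟩
    simpa only [mul_comm (f x)] using (hfderiv x hx hx0).fun_mul (hgderiv x hx hx0)

theorem mul (hf : HasIntegrableDeriv (n + 1) f) (hg : HasIntegrableDeriv (n + 1) g) :
    HasIntegrableDeriv (n + 1) (fun x => f x * g x) := by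
  have ⟨hfcont, f', hfderiv, hf'⟩ := hf
  have ⟨hgcont, g', hgderiv, hg'⟩ := hg
  refine ⟨hfcont.mul hgcont, fun x => f' x * g x + g' x * f x,
    fun x hx hx0 => ?_, (hf'.mul_of_succ hg).add (hg'.mul_of_succ hf)⟩
  simpa only [mul_comm (f x)] using (hfderiv x hx hx0).fun_mul (hgderiv x hx hx0)

theorem neg (hf : HasIntegrableDeriv n f) : HasIntegrableDeriv n (fun x => -f x) := by
  induction n generalizing f with
  | zero => exact IntervalIntegrable.neg hf
  | succ n ih =>
    obtain ⟨hcont, f', hderiv, hf'⟩ := hf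
    exact ⟨hcont.neg, _, fun x hx hx0 => (hderiv x hx hx0).neg, ih hf'⟩

theorem inv (hf : HasIntegrableDeriv (n + 1) f) (hf0 : ∀ x ∈ Ioo (-1 : ℝ) 1, f x ≠ 0) :
    HasIntegrableDeriv (n + 1) (fun x => (f x)⁻¹) := by
  have hderiv_inv {f' x : ℝ} (hx : f x ≠ 0) (hf' : HasDerivAt f f' x) :
      HasDerivAt (fun x => (f x)⁻¹) (-(f' * ((f x)⁻¹ * (f x)⁻¹))) x :=
    (hf'.fun_inv hx).congr_deriv (by field_simp)
  have hcont_inv : ContinuousOn (fun x => (f x)⁻¹) (Ioo (-1) 1) := hf.1.inv₀ hf0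
  induction n with
  | zero =>
    have ⟨_, f', hderiv, hf'⟩ := hf
    refine ⟨hcont_inv, _, fun x hx hx0 => hderiv_inv (hf0 x hx) (hderiv x hx hx0), ?_⟩
    exact (IntervalIntegrable.mul_continuousOn hf' ((hcont_inv.mul hcont_inv).mono
      (uIcc_half.trans_subset Icc_half_subset_Ioo_one))).neg
  | succ n ih =>
    have hinv := ih hf.of_succ
    have ⟨_, f', hderiv, hf'⟩ := hf
    exact ⟨hcont_inv, _, fun x hx hx0 => hderiv_inv (hf0 x hx) (hderiv x hx hx0),
      (hf'.mul (hinv.mul hinv)).neg⟩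

theorem of_contDiffOn (hf : ContDiffOn ℝ n f (Ioo (-1) 1)) : HasIntegrableDeriv n f := by
  induction n generalizing f with
  | zero =>
    exact (hf.continuousOn.mono
      (uIcc_half.trans_subset Icc_half_subset_Ioo_one)).intervalIntegrable
  | succ n ih =>
    rw [Nat.cast_succ, contDiffOn_succ_iff_deriv_of_isOpen isOpen_Ioo] at hf
    obtain ⟨hdiff, -, hderiv⟩ := hf
    exact ⟨hdiff.continuousOn, deriv f,
      fun x hx _ => (hdiff.differentiableAt (isOpen_Ioo.mem_nhds hx)).hasDerivAt, ih hderiv⟩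

end HasIntegrableDeriv

theorem hasDerivAt_abs_rpow_of_ne_zero (r : ℝ) {x : ℝ} (hx : x ≠ 0) :
    HasDerivAt (fun y : ℝ => |y| ^ r) (r * (x * |x| ^ (r - 2))) x := by
  refine ((hasDerivAt_abs hx).rpow_const (Or.inl (abs_ne_zero.2 hx))).congr_deriv ?_
  rw [show r - 1 = 1 + (r - 2) by ring, rpow_add (abs_pos.2 hx), rpow_one]
  linear_combination r * |x| ^ (r - 2) * sign_mul_abs x

theorem intervalIntegrable_mul_abs_rpow {r : ℝ} (hr : -2 < r) (a b : ℝ) :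
    IntervalIntegrable (fun x : ℝ => x * |x| ^ r) volume a b := by
  refine (intervalIntegrable_abs_rpow (show -1 < 1 + r by linarith) a b).mono_fun'
    (Measurable.aestronglyMeasurable (by fun_prop)) ?_
  filter_upwards [ae_restrict_of_ae (Measure.ae_ne volume 0)] with x hx0
  rw [norm_mul, norm_eq_abs, norm_of_nonneg (by positivity), rpow_add (abs_pos.2 hx0), rpow_one]

theorem hasIntegrableDeriv_abs_rpow {a : ℝ} (ha : 2 < a) :
    HasIntegrableDeriv 3 (fun x => |x| ^ a) := by
  have hpow {r : ℝ} (hr : 0 < r) : Continuous fun x : ℝ => |x| ^ r :=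
    continuous_abs.rpow_const fun _ => Or.inr hr.le
  refine ⟨(hpow (by linarith)).continuousOn, fun x => a * (x * |x| ^ (a - 2)),
    fun x _ hx0 => hasDerivAt_abs_rpow_of_ne_zero a hx0,
    ((continuous_id.mul (hpow (by linarith))).const_mul a).continuousOn,
    fun x => a * (a - 1) * |x| ^ (a - 2), fun x _ hx0 => ?_,
    ((hpow (by linarith)).const_mul _).continuousOn, _,
    fun x _ hx0 => (hasDerivAt_abs_rpow_of_ne_zero (a - 2) hx0).const_mul _,
    ((intervalIntegrable_mul_abs_rpow (by linarith) _ _).const_mul _).const_mul _⟩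
  refine (((hasDerivAt_id' x).fun_mul (hasDerivAt_abs_rpow_of_ne_zero (a - 2) hx0)).const_mul
    a).congr_deriv ?_
  have hsq : |x| ^ (a - 2) = x * x * |x| ^ (a - 2 - 2) := by
    rw [← abs_mul_abs_self x, ← sq, ← rpow_two, ← rpow_add (abs_pos.2 hx0)]
    ring_nf
  linear_combination -(a * (a - 2)) * hsq

theorem integral_mul_cos_eq_of_hasDerivAt {u u' : ℝ → ℝ}
    (hcont : ContinuousOn u (uIcc (-(1 / 2)) (1 / 2)))
    (hderiv : ∀ x ∈ Ioo (-1 : ℝ) 1, x ≠ 0 → HasDerivAt u (u' x) x)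
    (hint : IntervalIntegrable u' volume (-(1 / 2)) (1 / 2)) (hper : u (1 / 2) = u (-(1 / 2)))
    {j : ℕ} (hj : j ≠ 0) (θ : ℝ) :
    ∫ x in (-(1 / 2) : ℝ)..(1 / 2), u x * cos (2 * π * j * x + θ) =
      (2 * π * j)⁻¹ * ∫ x in (-(1 / 2) : ℝ)..(1 / 2), u' x * cos (2 * π * j * x + (θ + π / 2)) := by
  have : 2 * π * j ≠ 0 := by positivity
  have hsin (x : ℝ) : HasDerivAt (fun x => (2 * π * j)⁻¹ * sin (2 * π * j * x + θ))
      (cos (2 * π * j * x + θ)) x := by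
    refine (((((hasDerivAt_id' x).const_mul (2 * π * j)).add_const θ).sin).const_mul
      (2 * π * j)⁻¹).congr_deriv ?_
    field_simp
  have hboundary : sin (2 * π * j * (1 / 2) + θ) = sin (2 * π * j * (-(1 / 2)) + θ) := by
    rw [show 2 * π * j * (1 / 2) + θ = 2 * π * j * (-(1 / 2)) + θ + j * (2 * π) by ring,
      sin_add_nat_mul_two_pi]
  have hsin_int : IntervalIntegrable
      (fun x => u' x * ((2 * π * j)⁻¹ * sin (2 * π * j * x + θ))) volume (-(1 / 2)) (1 / 2) :=
    hint.mul_continuousOn (by fun_prop)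
  have hcos_int : IntervalIntegrable (fun x => u x * cos (2 * π * j * x + θ)) volume
      (-(1 / 2)) (1 / 2) := (hcont.mul (by fun_prop)).intervalIntegrable
  have hparts := integral_eq_of_hasDerivAt_off_countable
    (fun x => u x * ((2 * π * j)⁻¹ * sin (2 * π * j * x + θ))) _ (countable_singleton (0 : ℝ))
    (hcont.mul (by fun_prop))
    (fun x hx => (hderiv x (Icc_half_subset_Ioo_one (uIcc_half.subset (Ioo_subset_Icc_self hx.1)))
      hx.2).fun_mul (hsin x)) (hsin_int.add hcos_int)
  rw [intervalIntegral.integral_add hsin_int hcos_int, hper, hboundary, sub_self] at hparts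
  simp only [← add_assoc, cos_add_pi_div_two, mul_neg, intervalIntegral.integral_neg]
  simp only [mul_left_comm (u' _), intervalIntegral.integral_const_mul] at hparts
  linear_combination hparts

theorem HasIntegrableDeriv.exists_integral_mul_cos_le {n : ℕ} {f : ℝ → ℝ}
    (hf : HasIntegrableDeriv n f) (hper : ∀ x ∈ Ioo (-1 : ℝ) 0, f (x + 1) = f x) :
    ∃ C, ∀ j : ℕ, j ≠ 0 → ∀ θ : ℝ,
      |∫ x in (-(1 / 2) : ℝ)..(1 / 2), f x * cos (2 * π * j * x + θ)| ≤ C * ((j : ℝ) ^ n)⁻¹ := by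
  induction n generalizing f with
  | zero =>
    refine ⟨∫ x in (-(1 / 2) : ℝ)..(1 / 2), |f x|, fun j _ θ => ?_⟩
    rw [pow_zero, inv_one, mul_one]
    refine intervalIntegral.abs_integral_le_integral_abs (by norm_num) |>.trans
      (intervalIntegral.integral_mono_on (by norm_num) ?_ hf.intervalIntegrable.abs fun x _ => ?_)
    · exact (hf.intervalIntegrable.mul_continuousOn (by fun_prop)).abs
    · rw [abs_mul]
      exact mul_le_of_le_one_right (abs_nonneg _) (abs_cos_le_one _)
  | succ n ih =>
    have hcont := hf.continuousOn_uIcc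
    obtain ⟨-, f', hderiv, hf'⟩ := hf
    have hper' : ∀ x ∈ Ioo (-1 : ℝ) 0, f' (x + 1) = f' x := fun x hx =>
      ((hderiv (x + 1) ⟨by linarith [hx.1], by linarith [hx.2]⟩
        (by linarith [hx.1])).comp_add_const x 1).unique
        ((hderiv x ⟨hx.1, by linarith [hx.2]⟩ hx.2.ne).congr_of_eventuallyEq
          (by filter_upwards [isOpen_Ioo.mem_nhds hx] with y hy using hper y hy))
    have hends : f (1 / 2) = f (-(1 / 2)) := by
      rw [← hper (-(1 / 2)) (by norm_num)]
      norm_num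
    obtain ⟨C, hC⟩ := ih hf' hper'
    refine ⟨C, fun j hj θ => ?_⟩
    have hj0 : (0 : ℝ) < j := by positivity
    have hfreq : (2 * π * j)⁻¹ ≤ (j : ℝ)⁻¹ :=
      inv_anti₀ hj0 (le_mul_of_one_le_left hj0.le (by linarith [pi_gt_three]))
    rw [integral_mul_cos_eq_of_hasDerivAt hcont hderiv hf'.intervalIntegrable hends hj, abs_mul,
      abs_of_nonneg (by positivity), pow_succ', mul_inv (j : ℝ), mul_left_comm C]
    gcongr
    exact hC j hj _

theorem HasIntegrableDeriv.summable_rpow_mul_abs_cosCoeff {n : ℕ} {f : ℝ → ℝ}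
    (hf : HasIntegrableDeriv n f) (hper : ∀ x ∈ Ioo (-1 : ℝ) 0, f (x + 1) = f x) {s : ℝ}
    (hs : s + 1 < n) : Summable fun j : ℕ => (j : ℝ) ^ s * |cosCoeff f j| := by
  obtain ⟨C, hC⟩ := hf.exists_integral_mul_cos_le hper
  refine .of_norm_bounded_eventually_nat
    ((summable_nat_rpow.2 (show s - n < -1 by linarith)).mul_left C) ?_
  filter_upwards [eventually_ne_atTop 0] with j hj
  have hj0 : (0 : ℝ) < j := by positivity
  have hdecay : |cosCoeff f j| ≤ C * ((j : ℝ) ^ n)⁻¹ := by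
    simpa only [cosCoeff, add_zero] using hC j hj 0
  calc ‖(j : ℝ) ^ s * |cosCoeff f j|‖ = (j : ℝ) ^ s * |cosCoeff f j| :=
        norm_of_nonneg (by positivity)
    _ ≤ (j : ℝ) ^ s * (C * ((j : ℝ) ^ n)⁻¹) := by gcongr
    _ = C * (j : ℝ) ^ (s - n) := by
        rw [rpow_sub hj0, rpow_natCast]
        ring

/-! ### Regularity of the ratio for a smooth periodic density -/

theorem powKernel_add_one (b x : ℝ) : powKernel b (x + 1) = powKernel b x := by
  simp only [powKernel]
  rw [← (Equiv.addRight (1 : ℤ)).tsum_eq fun k : ℤ => |(k : ℝ) + x| ^ (-b)]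
  refine tsum_congr fun k => ?_
  rw [Equiv.coe_addRight, Int.cast_add, Int.cast_one, add_right_comm, add_assoc]

theorem sincWeight_mul_inv_eq {b : ℝ} (hb : 1 < b) {x : ℝ} (hx : |x| < 1) (hx0 : x ≠ 0) :
    sincWeight b x * (1 + |x| ^ b * regKernel b x)⁻¹
      = π ^ b * |sin (π * x)| ^ (-b) * (powKernel b x)⁻¹ := by
  have hreg := (one_add_regKernel_pos b hx).ne'
  have hpow := (rpow_pos_of_pos (abs_pos.2 hx0) b).ne'
  rw [sincWeight_eq b hx hx0, powKernel_eq_mul hb hx hx0, rpow_neg (abs_nonneg x)]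
  field_simp

theorem summable_rpow_mul_abs_ratioCoeff {H : ℝ} (hH : 1 / 2 < H) (hH1 : H < 1) {h : ℝ → ℝ}
    (h0 : h 0 ≠ 0) {p : ℝ → ℝ} (hp : Function.Periodic p 1) (hp3 : ContDiff ℝ 3 p)
    (hph : EqOn p h (Icc (-(1 / 2) : ℝ) (1 / 2))) :
    Summable fun j : ℕ => (j : ℝ) ^ (2 * H) * |ratioCoeff H h j| := by
  have hb : 2 < 2 * H + 1 := by linarith
  set b := 2 * H + 1
  set g : ℝ → ℝ := fun x => p x / h 0 * (sincWeight b x * (1 + |x| ^ b * regKernel b x)⁻¹)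
    with hg_def
  have hratio : ∀ j : ℕ, cosCoeff g j = ratioCoeff H h j := fun j =>
    intervalIntegral.integral_congr fun x hx => by
      have hx := uIcc_half.subset hx
      simp only [hg_def]
      rw [spectralRatio_eq (by linarith) h0 (abs_le.2 hx), hph hx, ← mul_assoc (h x / h 0)]
  have hden : HasIntegrableDeriv 3 (fun x => 1 + |x| ^ b * regKernel b x) :=
    (HasIntegrableDeriv.of_contDiffOn contDiffOn_const).add
      ((hasIntegrableDeriv_abs_rpow hb).mul (.of_contDiffOn (contDiffOn_regKernel 3 (by linarith))))
  have hg : HasIntegrableDeriv 3 g :=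
    (HasIntegrableDeriv.of_contDiffOn (hp3.contDiffOn.div_const _)).mul
      ((HasIntegrableDeriv.of_contDiffOn (contDiffOn_sincWeight b)).mul
        (hden.inv fun x hx => (one_add_regKernel_pos b (abs_lt.2 hx)).ne'))
  have hper : ∀ x ∈ Ioo (-1 : ℝ) 0, g (x + 1) = g x := fun x ⟨hx1, hx0⟩ => by
    simp only [hg_def]
    rw [sincWeight_mul_inv_eq (by linarith) (by rw [abs_lt]; constructor <;> linarith)
      (by linarith), sincWeight_mul_inv_eq (by linarith)
      (by rw [abs_lt]; constructor <;> linarith) hx0.ne, hp, powKernel_add_one, mul_add, mul_one,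
      sin_add_pi, abs_neg]
  simpa only [hratio] using
    hg.summable_rpow_mul_abs_cosCoeff hper (show 2 * H + 1 < (3 : ℕ) by norm_num; linarith)

/-! ### Reduction to even densities -/

/-- The even part of a function. A spectral density of a real process is even only up to a null
set, and may always be replaced by its even part. -/
noncomputable def evenPart (q : ℝ → ℝ) (x : ℝ) : ℝ := (q x + q (-x)) / 2

theorem evenPart_neg (q : ℝ → ℝ) (x : ℝ) : evenPart q (-x) = evenPart q x := by
  rw [evenPart, evenPart, neg_neg, add_comm]

theorem evenPart_zero (q : ℝ → ℝ) : evenPart q 0 = q 0 := by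
  rw [evenPart, neg_zero, add_self_div_two]

theorem continuousOn_evenPart {q : ℝ → ℝ} (hq : ContinuousOn q (Icc (-(1 / 2)) (1 / 2))) :
    ContinuousOn (evenPart q) (Icc (-(1 / 2)) (1 / 2)) :=
  (hq.add (hq.comp continuousOn_neg fun _ hx => ⟨neg_le_neg hx.2, neg_le.1 hx.1⟩)).div_const 2

theorem contDiffAt_evenPart {q : ℝ → ℝ} {n : WithTop ℕ∞} (hq : ContDiffAt ℝ n q 0) :
    ContDiffAt ℝ n (evenPart q) 0 :=
  (hq.add (ContDiffAt.comp 0 (by rwa [neg_zero]) contDiff_neg.contDiffAt)).div_const 2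

theorem intervalIntegrable_comp_neg {q : ℝ → ℝ} {a : ℝ} (hq : IntervalIntegrable q volume (-a) a) :
    IntervalIntegrable (fun x => q (-x)) volume (-a) a := by
  simpa using (IntervalIntegrable.comp_sub_left hq 0).symm

theorem integral_evenPart_smul {E : Type*} [NormedAddCommGroup E] [NormedSpace ℝ E] {q : ℝ → ℝ}
    {e : ℝ → E} {a : ℝ} (hq : IntervalIntegrable q volume (-a) a) (he : Continuous e) :
    ∫ x in (-a)..a, evenPart q x • e x
      = (2⁻¹ : ℝ) • ((∫ x in (-a)..a, q x • e x) + ∫ x in (-a)..a, q x • e (-x)) := by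
  have hneg : ∫ x in (-a)..a, q x • e (-x) = ∫ x in (-a)..a, q (-x) • e x := by
    simpa only [neg_neg] using
      (intervalIntegral.integral_comp_neg (fun x => q x • e (-x)) (a := -a) (b := a)).symm
  rw [hneg, ← intervalIntegral.integral_add (hq.smul_continuousOn he.continuousOn)
    ((intervalIntegrable_comp_neg hq).smul_continuousOn he.continuousOn),
    ← intervalIntegral.integral_smul]
  refine intervalIntegral.integral_congr fun x _ => ?_
  rw [← add_smul, smul_smul, evenPart, div_eq_inv_mul]

theorem hasSpectralDensity_evenPart {Ω : Type*} [MeasurableSpace Ω] {μ : Measure Ω}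
    {Y : ℤ → Ω → ℝ} {h : ℝ → ℝ} (hY : HasSpectralDensity μ Y h) :
    HasSpectralDensity μ Y (evenPart h) where
  nonneg x hx := div_nonneg
    (add_nonneg (hY.nonneg x hx) (hY.nonneg (-x) ⟨neg_le_neg hx.2, neg_le.1 hx.1⟩)) zero_le_two
  integrable := (hY.integrable.add (intervalIntegrable_comp_neg hY.integrable)).div_const 2
  covariance_eq s t := by
    have hcov := integral_evenPart_smul hY.integrable (e := fun x : ℝ =>
      Complex.exp (2 * π * Complex.I * ((t : ℂ) - (s : ℂ)) * (x : ℂ))) (by fun_prop)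
    have hswap (x : ℝ) : Complex.exp (2 * π * Complex.I * ((t : ℂ) - (s : ℂ)) * (-x : ℝ))
        = Complex.exp (2 * π * Complex.I * ((s : ℂ) - (t : ℂ)) * (x : ℂ)) := by
      push_cast
      ring_nf
    simp only [Complex.real_smul, hswap, ← hY.covariance_eq] at hcov
    rw [hcov, covariance_comm (Y t)]
    push_cast
    ring

section Ratio

variable {H : ℝ} {g h : ℝ → ℝ}

theorem fracPrefactor_evenPart (H : ℝ) (h : ℝ → ℝ) :
    fracPrefactor H (evenPart h) = fracPrefactor H h := by
  rw [fracPrefactor, fracPrefactor, evenPart_zero]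

theorem spectralRatio_evenPart (hH : 0 < H) (h0 : h 0 ≠ 0) {x : ℝ} (hx : |x| ≤ 1 / 2) :
    spectralRatio H (evenPart h) x = evenPart (spectralRatio H h) x := by
  rw [spectralRatio_eq hH (by rwa [evenPart_zero]) hx, evenPart_zero, evenPart, evenPart,
    spectralRatio_eq hH h0 hx, spectralRatio_eq hH h0 (by rwa [abs_neg]), sincWeight_neg,
    regKernel_neg, abs_neg]
  ring

theorem cosCoeff_evenPart (hg : IntervalIntegrable g volume (-(1 / 2)) (1 / 2)) (t : ℝ) :
    cosCoeff (evenPart g) t = cosCoeff g t := by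
  have h := integral_evenPart_smul hg (e := fun x => cos (2 * π * t * x)) (by fun_prop)
  simp only [smul_eq_mul, mul_neg, cos_neg] at h
  rw [cosCoeff, h, ← two_mul, inv_mul_cancel_left₀ two_ne_zero, cosCoeff]

theorem ratioCoeff_evenPart (hH : 0 < H) (h0 : h 0 ≠ 0)
    (hcont : ContinuousOn h (Icc (-(1 / 2)) (1 / 2))) (j : ℕ) :
    ratioCoeff H (evenPart h) j = ratioCoeff H h j := by
  have hint : IntervalIntegrable (spectralRatio H h) volume (-(1 / 2)) (1 / 2) :=
    ContinuousOn.intervalIntegrable (uIcc_half.symm ▸ continuousOn_spectralRatio hH h0 hcont)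
  refine Eq.trans ?_ (cosCoeff_evenPart hint j)
  refine intervalIntegral.integral_congr fun x hx => ?_
  rw [spectralRatio_evenPart hH h0 (abs_le.2 (uIcc_half.subset hx))]

end Ratio

/-! ### Asymptotics of the variance and correlation time functions -/

section Asymptotics

variable {Ω : Type*} [MeasurableSpace Ω] {μ : Measure Ω} {X : ℤ → Ω → ℝ} {H : ℝ} {f h : ℝ → ℝ}

theorem fgnVariance_pos {c : ℝ} (hH : 0 < H) (hH1 : H < 1) (hc : 0 < c) : 0 < fgnVariance H c := by
  have := sineIntegral_pos (s := 2 * H) (by linarith) (by linarith)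
  rw [fgnVariance_eq hH hH1]
  positivity

theorem tendsto_vtf_sub_fgnVTF (hH : 1 / 2 ≤ H) (hH1 : H < 1) (h0 : 0 < h 0)
    (hcont : ContinuousOn h (Icc (-(1 / 2)) (1 / 2))) (hdiff : ContDiffAt ℝ 2 h 0)
    (heven : ∀ x, h (-x) = h x) (hX : HasSpectralDensity μ X (fracSpectralDensity H h)) :
    Tendsto (fun n : ℕ => vtf μ X n - fgnVTF H (fgnVariance H (fracPrefactor H h)) n) atTop
      (𝓝 (fgnVariance H (fracPrefactor H h) * additiveConst H (spectralRatio H h))) := by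
  have hH0 : 0 < H := by linarith
  obtain ⟨C, hC⟩ := exists_abs_spectralRatio_sub_one_le hH h0.ne' hcont hdiff heven
  have hratio : ContinuousOn (fun x => spectralRatio H h x - 1) (Icc (-(1 / 2)) (1 / 2)) :=
    (continuousOn_spectralRatio hH0 h0.ne' hcont).sub continuousOn_const
  simp_rw [vtf_eq_fejerIntegral hX]
  exact tendsto_fejerIntegral_sub_fgnVTF hH0 hH1 h0
    (intervalIntegrable_powKernel_mul (by linarith) (by linarith) hratio hC)

theorem isLittleO_ctf_aggregate_sub [IsFiniteMeasure μ] (hX2 : ∀ t, MemLp (X t) 2 μ)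
    (hX : HasSpectralDensity μ X f) (hH : 0 < H) {V D : ℝ} (hV : 0 < V)
    (hω : Tendsto (fun n : ℕ => vtf μ X n - fgnVTF H V n) atTop (𝓝 (V * D)))
    {n : ℕ} (hn : 1 ≤ n) :
    (fun m : ℕ => ctf μ (aggregate X m) n
        - (fgnCTF H n + D * (1 - (n : ℝ) ^ (2 * H)) * (m : ℝ) ^ (-(2 * H))))
      =o[atTop] fun m : ℕ => (m : ℝ) ^ (-(2 * H)) := by
  refine (isLittleO_div_sub_rpow hV (by linarith) hω hn).congr' ?_ EventuallyEq.rfl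
  filter_upwards [eventually_ne_atTop 0] with m hm
  rw [ctf_aggregate hX2 hX.covariance_eq_acvf hm, fgnCTF]

theorem isBigO_ctf_aggregate_sub [IsFiniteMeasure μ] (hX2 : ∀ t, MemLp (X t) 2 μ)
    (hX : HasSpectralDensity μ X f) (hH : 0 < H) {V D : ℝ} (hV : 0 < V)
    (hω : Tendsto (fun n : ℕ => vtf μ X n - fgnVTF H V n) atTop (𝓝 (V * D)))
    {n : ℕ} (hn : 1 ≤ n) :
    (fun m : ℕ => ctf μ (aggregate X m) n - fgnCTF H n)
      =O[atTop] fun m : ℕ => (m : ℝ) ^ (-(2 * H)) := by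
  refine ((isLittleO_ctf_aggregate_sub hX2 hX hH hV hω hn).isBigO.add
    (isBigO_const_mul_self (D * (1 - (n : ℝ) ^ (2 * H))) _ _)).congr_left fun m => ?_
  ring

end Asymptotics

end FracDiff

section General

open FracDiff

theorem mainTheorem3_general {Ω : Type*} [MeasurableSpace Ω] (μ : Measure Ω)
    [IsProbabilityMeasure μ] (H : ℝ) (hH : 1 / 2 < H) (hH1 : H < 1)
    (h : ℝ → ℝ) (h0 : 0 < h 0) (hcont : ContinuousOn h (Set.Icc (-(1 / 2) : ℝ) (1 / 2)))
    (hdiff : ContDiffAt ℝ 2 h 0) (X Y : ℤ → Ω → ℝ) (hY : ∀ t, MemLp (Y t) 2 μ)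
    (hYh : FracDiff.HasSpectralDensity μ Y h)
    (hX : FracDiff.IsFracDiff μ (-(H - 1 / 2)) Y X) :
    ∃ D : ℝ,
      (∀ n : ℕ, 1 ≤ n →
        (fun m : ℕ => FracDiff.ctf μ (FracDiff.aggregate X m) n -
            (FracDiff.fgnCTF H n + D * (1 - (n : ℝ) ^ (2 * H)) * (m : ℝ) ^ (-(2 * H))))
          =o[atTop] (fun m : ℕ => (m : ℝ) ^ (-(2 * H))) ∧
        (fun m : ℕ => FracDiff.ctf μ (FracDiff.aggregate X m) n - FracDiff.fgnCTF H n)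
          =O[atTop] (fun m : ℕ => (m : ℝ) ^ (-(2 * H)))) ∧
      Tendsto (fun n : ℕ => FracDiff.vtf μ X n -
          FracDiff.fgnVTF H (FracDiff.fgnVariance H (FracDiff.fracPrefactor H h)) n)
        atTop (𝓝 (FracDiff.fgnVariance H (FracDiff.fracPrefactor H h) * D)) ∧
      ((Summable fun j : ℕ => (j : ℝ) ^ (2 * H) * |FracDiff.ratioCoeff H h j|) →
        D = -2 * ∑' j : ℕ, (j : ℝ) ^ (2 * H) * FracDiff.ratioCoeff H h j) ∧
      ((∃ p : ℝ → ℝ, Function.Periodic p 1 ∧ ContDiff ℝ 3 p ∧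
          Set.EqOn p h (Set.Icc (-(1 / 2) : ℝ) (1 / 2))) →
        Summable fun j : ℕ => (j : ℝ) ^ (2 * H) * |FracDiff.ratioCoeff H h j|) := by
  have hH0 : 0 < H := by linarith
  have he0 : 0 < evenPart h 0 := (evenPart_zero h).symm ▸ h0
  have hecont := continuousOn_evenPart hcont
  have hXe : HasSpectralDensity μ X (fracSpectralDensity H (evenPart h)) :=
    hX.hasSpectralDensity hH (by linarith) hY (hasSpectralDensity_evenPart hYh)
      (intervalIntegrable_fracSpectralDensity hH.le hH1 hecont)
  have hω := tendsto_vtf_sub_fgnVTF hH.le hH1 he0 hecont (contDiffAt_evenPart hdiff)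
    (evenPart_neg h) hXe
  rw [fracPrefactor_evenPart] at hω
  have hV : 0 < fgnVariance H (fracPrefactor H h) :=
    fgnVariance_pos hH0 hH1 (fracPrefactor_pos h0)
  refine ⟨additiveConst H (spectralRatio H (evenPart h)), fun n hn =>
    ⟨isLittleO_ctf_aggregate_sub hX.memLp hXe hH0 hV hω hn,
      isBigO_ctf_aggregate_sub hX.memLp hXe hH0 hV hω hn⟩, hω, fun hsum => ?_,
    fun ⟨p, hp, hp3, hph⟩ => summable_rpow_mul_abs_ratioCoeff hH hH1 h0.ne' hp hp3 hph⟩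
  simp only [← ratioCoeff_evenPart hH0 h0.ne' hcont] at hsum ⊢
  exact additiveConst_eq_tsum hH0 hH1
    (fun x hx => spectralRatio_neg (evenPart_neg h) hH0 he0.ne' hx) (if_pos rfl)
    (continuousOn_spectralRatio hH0 he0.ne' hecont) hsum

end General

theorem mainTheorem3 {Ω : Type*} [MeasurableSpace Ω] (μ : Measure Ω) [IsProbabilityMeasure μ]
    (H : ℝ) (hH : 1 / 2 < H) (hH1 : H < 1)
    (h : ℝ → ℝ) (hpos : ∀ x ∈ Set.Icc (-(1 / 2) : ℝ) (1 / 2), 0 < h x)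
    (hcont : ContinuousOn h (Set.Icc (-(1 / 2) : ℝ) (1 / 2)))
    (hdiff : ContDiffOn ℝ 3 h (Set.Ioo (-(1 / 2) : ℝ) (1 / 2)))
    (X Y : ℤ → Ω → ℝ)
    (hY : FracDiff.IsSecondOrderStationary μ Y)
    (hYh : FracDiff.HasSpectralDensity μ Y h)
    (hX : FracDiff.IsFracDiff μ (-(H - 1 / 2)) Y X) :
    ∃ D : ℝ,
      -- speed of convergence of the CTF under aggregation
      (∀ n : ℕ, 1 ≤ n →
        (fun m : ℕ => FracDiff.ctf μ (FracDiff.aggregate X m) n -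
            (FracDiff.fgnCTF H n + D * (1 - (n : ℝ) ^ (2 * H)) * (m : ℝ) ^ (-(2 * H))))
          =o[atTop] (fun m : ℕ => (m : ℝ) ^ (-(2 * H))) ∧
        (fun m : ℕ => FracDiff.ctf μ (FracDiff.aggregate X m) n - FracDiff.fgnCTF H n)
          =O[atTop] (fun m : ℕ => (m : ℝ) ^ (-(2 * H)))) ∧
      -- `D` is the additive constant, relative to `V`, between the VTF and that of its fGn limit
      Tendsto (fun n : ℕ => FracDiff.vtf μ X n -
          FracDiff.fgnVTF H (FracDiff.fgnVariance H (FracDiff.fracPrefactor H h)) n)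
        atTop (𝓝 (FracDiff.fgnVariance H (FracDiff.fracPrefactor H h) * D)) ∧
      -- `D = -2 ∑_{j ≥ 1} j^{2H} G_j` whenever the series converges absolutely
      ((Summable fun j : ℕ => (j : ℝ) ^ (2 * H) * |FracDiff.ratioCoeff H h j|) →
        D = -2 * ∑' j : ℕ, (j : ℝ) ^ (2 * H) * FracDiff.ratioCoeff H h j) ∧
      -- it does so as soon as the periodic extension of `h` is `C³`
      ((∃ p : ℝ → ℝ, Function.Periodic p 1 ∧ ContDiff ℝ 3 p ∧
          Set.EqOn p h (Set.Icc (-(1 / 2) : ℝ) (1 / 2))) →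
        Summable fun j : ℕ => (j : ℝ) ^ (2 * H) * |FracDiff.ratioCoeff H h j|) :=
  mainTheorem3_general μ H hH hH1 h (hpos 0 ⟨by norm_num, by norm_num⟩) hcont
    ((hdiff.contDiffAt (Ioo_mem_nhds (by norm_num) (by norm_num))).of_le (by norm_num))
    X Y hY.memLp hYh hX
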